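/- All graphs are simple graphs, viewed as structures in the language with one binary relation symbol. Let $\mathcal M$ be a countably infinite graph that is ultrahomogeneous (every isomorphism between finite induced subgraphs extends to an automorphism) and has trivial definable closure (for every finite $X\subseteq\mathcal M$, the only vertices fixed by all automorphisms fixing $X$ pointwise are those of $X$). **Axioms.** Let $\langle\varphi_i\rangle_{i\in\mathbb N}$ be a sequence of quantifier-free first-order formulas $\varphi_i(x_1,\dots,x_{\ell_i},y)$ ($\ell_i\ge 0$), each occurring infinitely often in the sequence, such that the sentences $(\forall \mathbf x)(\exists y)\varphi_i(\mathbf x,y)$, $i\in\mathbb N$, axiomatize the first-order theory of $\mathcal M$. **Branching.** Let $A\subseteq\mathcal M$ be finite. A family of finite sets $S_s\subseteq\mathcal M$ ($s\in A$) is a *branching* of $A$ if $s\in S_s$ for each $s \in A$ and, for every choice of $s'\in S_s$ ($s\in A$), the tuples $(s)_{s\in A}$ and $(s')_{s\in A}$ have the same quantifier-free type. The elements of $S_s$ are the *offshoots* of $s$, and $s$ branches into $|S_s|$ offshoots. **Construction.** Finite vertex sets $M_n^k$ ($0\le k\le n$) of induced subgraphs of $\mathcal M$, and finite sets $B(n,i)$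 ($0\le i\le n$), are built as follows. * $M_0^0$ is any finite nonempty set of vertices of $\mathcal M$, and $B(0,0)=M_0^0$. * Substage $(n,0)$, $n>0$: let $A$ be the set of tuples $\mathbf a$ of length $\ell_n$ (repetitions allowed) from $M_{n-1}^{n-1}$ such that $\varphi_n(\mathbf a,b)$ holds for no entry $b$ of $\mathbf a$. If $A\ne\emptyset$, choose distinct vertices $d_{\mathbf a}\in \mathcal M\setminus M_{n-1}^{n-1}$ ($\mathbf a\in A$) such that $\varphi_n(\mathbf a,d_{\mathbf a})$ holds, and let $B(n,n)=\{d_{\mathbf a}:\mathbf a\in A\}$. If $A=\emptyset$, let $B(n,n)$ consist of one arbitrary vertex of $\mathcal M\setminus M_{n-1}^{n-1}$. Put $M_n^0=M_{n-1}^{n-1}\cup B(n,n)$. * Substage $(n,k)$, $0<k\le n$: let $\alpha_n=2^{n-1}|B(n,n)|$. Choose a branching $(S_s)$ of $M_n^{k-1}$ with $|S_s|=\alpha_n$ for $s\in B(n-1,n-k)$ and $S_s=\{s\}$ for the other $s$. Put $M_n^k=\bigcup_{s\in M_n^{k-1}}S_s$ and $B(n,n-k)=\bigcup_{s\in B(n-1,n-k)}S_s$.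 Let $\mathcal M_n$ be the subgraph of $\mathcal M$ induced on $M_n^n$. **Sampling.** For a finite nonempty graph $F$, let $\mathbb G(\mathbb N,F)$ be the random graph on $\mathbb N$ obtained from i.i.d. uniformly distributed vertices $x_0,x_1,\dots$ of $F$, with an edge between $j$ and $k$ exactly when $x_j$ and $x_k$ have an edge between them in $F$. Graphs on $\mathbb N$ carry the product topology on the truth values of "$i$ and $j$ are adjacent" and its Borel $\sigma$-algebra; $S_\infty$, the group of all permutations of $\mathbb N$, acts on them by relabelling. **Claim.** A sequence $\langle\varphi_i\rangle$ as above exists. For every such sequence and every finite nonempty set $M_0^0$ of vertices, the construction can be carried out starting from $M_0^0$. For every such sequence and every outcome of the construction (whatever choices are made), the random graphs $\mathbb G(\mathbb N,\mathcal M_n)$ converge in distribution, as $n\to\infty$, to a random graph on $\mathbb N$ whose distribution $\mu$ is $S_\infty$-invariant. The set of graphs on $\mathbb N$ that are isomorphic to $\mathcal M$ is Borel, and $\mu$ is concentrated on it, i.e. gives it measure $1$. -/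

import Mathlib

open MeasureTheory Filter Topology FirstOrder

noncomputable section

namespace ToyConstr

/-! ### Model-theoretic notions -/

/-- The definable closure of `X` in the structure `M`: the elements fixed by every automorphism
that fixes `X` pointwise. -/
def definableClosure (L : Language) (M : Type*) [L.Structure M] (X : Set M) : Set M :=
  {b | ∀ g : M ≃[L] M, (∀ x ∈ X, g x = x) → g b = b}

/-- `M` has trivial definable closure: `dcl(X) = X` for every finite `X`. -/
def HasTrivialDcl (L : Language) (M : Type*) [L.Structure M] : Prop :=
  ∀ X : Set M, X.Finite → definableClosure L M X = X

/-- Two tuples in a structure have the same quantifier-free type. -/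
def SameQFType (L : Language) {M : Type*} [L.Structure M] {ι : Type*} (a b : ι → M) : Prop :=
  ∀ ψ : L.Formula ι, ψ.IsQF → (ψ.Realize a ↔ ψ.Realize b)

/-- The graph `G`, as a structure in the language of graphs, is ultrahomogeneous. -/
def IsUltrahomogeneousGraph {V : Type*} (G : SimpleGraph V) : Prop :=
  @Language.IsUltrahomogeneous Language.graph V G.structure

/-- The graph `G`, as a structure in the language of graphs, has trivial definable closure. -/
def HasTrivialDclGraph {V : Type*} (G : SimpleGraph V) : Prop :=
  @HasTrivialDcl Language.graph V G.structure

/-- A formula `φ(x₀, …, x_{ℓ-1}, y)` in the language of graphs, together with the length `ℓ`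
(possibly `0`) of the tuple `x`. The last variable is `y`. -/
abbrev PithyMatrix : Type := Σ ℓ : ℕ, Language.graph.BoundedFormula Empty (ℓ + 1)

/-- The sentence `(∀ x)(∃ y) φ(x, y)`. -/
def PithyMatrix.sentence (φ : PithyMatrix) : Language.graph.Sentence := φ.2.ex.alls

/-- `φ(a, b)` holds in the graph `G`. For quantifier-free `φ` this is the same as `φ(a, b)` holding
in any induced subgraph that contains `a` and `b`. -/
def PithyMatrix.Holds {V : Type*} (G : SimpleGraph V) (φ : PithyMatrix) (a : Fin φ.1 → V) (b : V) : Prop :=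
  letI := G.structure
  φ.2.Realize default (Fin.snoc a b : Fin (φ.1 + 1) → V)

/-- The sequence `φ` consists of quantifier-free formulas, each of them listed infinitely often,
and the first-order theory of `G` is axiomatized by the sentences `(∀ x)(∃ y) φᵢ(x, y)`. -/
structure IsPithyAxiomatization {V : Type*} (G : SimpleGraph V) (φ : ℕ → PithyMatrix) : Prop where
  isQF : ∀ i, (φ i).2.IsQF
  infinitely_often : ∀ i, {j | φ j = φ i}.Infinite
  axiomatizes : ∀ ψ : Language.graph.Sentence,
    ψ ∈ @Language.completeTheory Language.graph V G.structure ↔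
      (Set.range fun i => (φ i).sentence : Language.graph.Theory) ⊨ᵇ ψ

/-! ### The construction of the finite subgraphs -/

section Construction

variable {V : Type*} (G : SimpleGraph V)

/-- The family `(S s)_{s ∈ A}` is a branching of the elements of the finite set `A`: each `S s` is
a finite set of vertices of `G` that contains `s` (the offshoots of `s`), and each way of
replacing every `s ∈ A` by one of its offshoots preserves the quantifier-free type. -/
def IsBranching (A : Finset V) (S : V → Finset V) : Prop :=
  letI := G.structure
  (∀ s ∈ A, s ∈ S s) ∧
    ∀ f : A → V, (∀ s : A, f s ∈ S s) → SameQFType Language.graph (fun s : A => (s : V)) f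

/-- The tuples in `X` that need a new witness: those tuples `a` such that no entry `b` of `a`
satisfies `φ(a, b)`. -/
def needsWitness (φ : PithyMatrix) (X : Finset V) : Set (Fin φ.1 → V) :=
  {a | (∀ i, a i ∈ X) ∧ ¬ ∃ i, φ.Holds G a (a i)}

/-- `B` is a possible new slice above `X` for the formula `φ`: if some tuple needs a witness, then
`B` consists of distinct vertices `d a` outside `X`, one for each such tuple `a`, with `φ(a, d a)`;
otherwise `B` consists of a single vertex outside `X`. -/
def IsNewSlice (φ : PithyMatrix) (X B : Finset V) : Prop :=
  ((needsWitness G φ X).Nonempty ∧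
    ∃ d : (Fin φ.1 → V) → V, Set.InjOn d (needsWitness G φ X) ∧
      (∀ a ∈ needsWitness G φ X, d a ∉ X ∧ φ.Holds G a (d a)) ∧
      (B : Set V) = d '' needsWitness G φ X) ∨
  (needsWitness G φ X = ∅ ∧ ∃ b, b ∉ X ∧ B = {b})

/-- A run of the construction for the graph `G` and the enumeration `φ` of formulas.
`stage n k` (for `k ≤ n`) is the vertex set of the induced subgraph built at substage `(n, k)`, and
`slice n i` (for `i ≤ n`) is the `i`-th slice of stage `n`; other values are irrelevant. -/
structure Run (φ : ℕ → PithyMatrix) where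
  stage : ℕ → ℕ → Finset V
  slice : ℕ → ℕ → Finset V
  /-- Substage `(0, 0)`: a finite nonempty set of vertices. -/
  stage_zero_nonempty : (stage 0 0).Nonempty
  slice_zero : slice 0 0 = stage 0 0
  /-- Substage `(n + 1, 0)`: a slice of new witnesses is added. -/
  isNewSlice : ∀ n, IsNewSlice G (φ (n + 1)) (stage n n) (slice (n + 1) (n + 1))
  stage_succ_zero : ∀ n,
    (stage (n + 1) 0 : Set V) = (stage n n : Set V) ∪ (slice (n + 1) (n + 1) : Set V)
  /-- Substage `(n + 1, k + 1)`: each element of the old slice number `n - k` branches into precisely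
  `2 ^ n * |slice (n + 1) (n + 1)|` offshoots, the other elements do not branch, and the offshoots
  are the only new elements. -/
  branch : ∀ n k, k ≤ n → ∃ S : V → Finset V,
    IsBranching G (stage (n + 1) k) S ∧
    (∀ s ∈ slice n (n - k), (S s).card = 2 ^ n * (slice (n + 1) (n + 1)).card) ∧
    (∀ s ∈ stage (n + 1) k, s ∉ slice n (n - k) → S s = {s}) ∧
    (stage (n + 1) (k + 1) : Set V) = ⋃ s ∈ stage (n + 1) k, (S s : Set V) ∧
    (slice (n + 1) (n - k) : Set V) = ⋃ s ∈ slice n (n - k), (S s : Set V)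

variable {G} {φ : ℕ → PithyMatrix}

lemma Run.stage_succ_nonempty (R : Run G φ) (n : ℕ) (h : (R.stage n n).Nonempty) :
    ∀ k, k ≤ n + 1 → (R.stage (n + 1) k).Nonempty := by
  intro k
  induction k with
  | zero =>
    intro _
    rw [← Finset.coe_nonempty, R.stage_succ_zero]
    exact (Finset.coe_nonempty.2 h).mono Set.subset_union_left
  | succ k ih =>
    intro hk
    obtain ⟨s, hs⟩ := ih (by omega)
    obtain ⟨S, hS, -, -, hst, -⟩ := R.branch n k (by omega)
    rw [← Finset.coe_nonempty, hst]
    exact ⟨s, Set.mem_biUnion hs (hS.1 s hs)⟩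

lemma Run.stage_nonempty (R : Run G φ) (n : ℕ) : (R.stage n n).Nonempty := by
  induction n with
  | zero => exact R.stage_zero_nonempty
  | succ n ih => exact R.stage_succ_nonempty n ih (n + 1) le_rfl

/-- The vertex set of the finite graph built at stage `n` of the construction. -/
def Run.verts (R : Run G φ) (n : ℕ) : Set V := (R.stage n n : Set V)

instance (R : Run G φ) (n : ℕ) : Fintype (R.verts n) :=
  inferInstanceAs (Fintype ((R.stage n n : Finset V) : Set V))

instance (R : Run G φ) (n : ℕ) : Nonempty (R.verts n) :=
  (R.stage_nonempty n).to_subtype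

/-- The finite graph built at stage `n` of the construction: an induced subgraph of `G`. -/
def Run.graph (R : Run G φ) (n : ℕ) : SimpleGraph (R.verts n) := G.induce (R.verts n)

end Construction

/-! ### Random graphs with vertex set `ℕ` -/

/-- The topology on the space of graphs with vertex set `ℕ`: the product topology on the truth
values of all `H.Adj i j`. -/
instance graphTopology : TopologicalSpace (SimpleGraph ℕ) :=
  open Classical in
  TopologicalSpace.induced (fun H (p : ℕ × ℕ) => decide (H.Adj p.1 p.2)) inferInstance

/-- Mathlib's σ-algebra on `SimpleGraph ℕ`, generated by the events `H.Adj i j`, is the Borel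
σ-algebra of this topology. -/
instance graphBorelSpace : BorelSpace (SimpleGraph ℕ) := by
  classical
  constructor
  have h : borel (SimpleGraph ℕ) = MeasurableSpace.comap
      (fun (H : SimpleGraph ℕ) (p : ℕ × ℕ) => decide (H.Adj p.1 p.2)) inferInstance := by
    rw [(BorelSpace.measurable_eq : (inferInstance : MeasurableSpace (ℕ × ℕ → Bool)) = borel _),
      ← borel_comap]
  rw [h]
  apply le_antisymm
  · have : @Measurable _ _ (MeasurableSpace.comap
      (fun (H : SimpleGraph ℕ) (p : ℕ × ℕ) => decide (H.Adj p.1 p.2)) inferInstance) _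
      (id : SimpleGraph ℕ → SimpleGraph ℕ) := by
      rw [SimpleGraph.measurable_iff_adj]
      intro u v
      have h1 := (measurable_pi_apply (u, v)).comp (comap_measurable
        (fun (H : SimpleGraph ℕ) (p : ℕ × ℕ) => decide (H.Adj p.1 p.2)))
      have h2 : Measurable (fun b : Bool => (b = true : Prop)) := measurable_of_finite _
      have h3 := h2.comp h1
      simpa [Function.comp_def] using h3
    simpa using this.comap_le
  · rw [← measurable_iff_comap_le, measurable_pi_iff]
    intro p
    have h1 : Measurable (fun H : SimpleGraph ℕ => H.Adj p.1 p.2) :=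
      SimpleGraph.measurable_iff_adj.1 measurable_id p.1 p.2
    have h2 : Measurable (fun q : Prop => decide q) := fun s _ => MeasurableSpace.measurableSet_top
    exact h2.comp h1

section Sampling

variable {W : Type*} [Fintype W]

/-- The law of a sequence of independent uniformly distributed elements of the finite set `W`. -/
def iidUniform (W : Type*) [Fintype W] [Nonempty W] :
    @Measure (ℕ → W) (@MeasurableSpace.pi ℕ (fun _ => W) fun _ => ⊤) :=
  letI : MeasurableSpace W := ⊤
  Measure.infinitePi fun _ : ℕ => (PMF.uniformOfFintype W).toMeasure

/-- The graph on `ℕ` with an edge between `j` and `k` iff `x j` and `x k` have an edge in `F`. -/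
def pullbackGraph (F : SimpleGraph W) (x : ℕ → W) : SimpleGraph ℕ := F.comap x

/-- The distribution of the infinite random graph `𝔾(ℕ, F)` induced from the finite graph `F` by
sampling vertices with replacement. -/
def sampledMeasure [Nonempty W] (F : SimpleGraph W) : Measure (SimpleGraph ℕ) :=
  @Measure.map _ _ (@MeasurableSpace.pi ℕ (fun _ => W) fun _ => ⊤) _ (pullbackGraph F)
    (iidUniform W)

lemma measurable_pullbackGraph (F : SimpleGraph W) :
    @Measurable _ _ (@MeasurableSpace.pi ℕ (fun _ => W) fun _ => ⊤) _ (pullbackGraph F) := by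
  let _ : MeasurableSpace W := ⊤
  rw [SimpleGraph.measurable_iff_adj]
  intro u v
  have h : Measurable fun p : W × W => F.Adj p.1 p.2 := measurable_of_finite _
  have h' : Measurable fun x : ℕ → W => (x u, x v) :=
    (measurable_pi_apply u).prodMk (measurable_pi_apply v)
  exact h.comp h'

instance [Nonempty W] (F : SimpleGraph W) : IsProbabilityMeasure (sampledMeasure F) := by
  let _ : MeasurableSpace W := ⊤
  have : IsProbabilityMeasure (iidUniform W) := by unfold iidUniform; infer_instance
  exact Measure.isProbabilityMeasure_map (measurable_pullbackGraph F).aemeasurable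

/-- The distribution of `𝔾(ℕ, F)` as an element of the space of probability measures on graphs,
which carries the topology of convergence in distribution. -/
def sampledGraph [Nonempty W] (F : SimpleGraph W) : ProbabilityMeasure (SimpleGraph ℕ) :=
  ⟨sampledMeasure F, inferInstance⟩

end Sampling

/-- The action of the permutations of `ℕ` on graphs with vertex set `ℕ`:
`j` and `k` are adjacent in `g • H` iff `g⁻¹ j` and `g⁻¹ k` are adjacent in `H`. -/
def logicAction (g : Equiv.Perm ℕ) (H : SimpleGraph ℕ) : SimpleGraph ℕ := H.comap ⇑g⁻¹

/-- `μ` is invariant under all permutations of `ℕ`. -/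
def IsSymInvariant (μ : Measure (SimpleGraph ℕ)) : Prop :=
  ∀ (g : Equiv.Perm ℕ) (X : Set (SimpleGraph ℕ)), MeasurableSet X → μ (logicAction g '' X) = μ X

/-- The graphs with vertex set `ℕ` that are isomorphic to `G`. -/
def isoClass {V : Type*} (G : SimpleGraph V) : Set (SimpleGraph ℕ) := {H | Nonempty (H ≃g G)}

/-- `μ` is concentrated on the measurable set `X`. -/
def IsConcentratedOn (μ : Measure (SimpleGraph ℕ)) (X : Set (SimpleGraph ℕ)) : Prop :=
  MeasurableSet X ∧ μ X = 1

end ToyConstr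

end

/-! All samples are coupled on one probability space. A vertex of stage `n + 1` is either a new
witness or an offshoot of a unique parent in stage `n`. If there are `b` new witnesses, every vertex
of stage `n` has exactly `2 ^ n * b` offshoots. Hence a uniform vertex of stage `n + 1` is new with
probability at most `2⁻ⁿ`, and otherwise has a uniform parent. So a uniform vertex `w` of stage `n`
can be continued to a uniform vertex of stage `n + 1`: draw a uniform candidate `c`, jump to `c` if
it is new, and otherwise move to the offshoot of `w` with the same rank as `c` among its siblings
(`IsTower.exists_next`).

Run infinitely many independent copies of this chain. By Borel–Cantelli each jumps only finitely
often, and any two are eventually distinct because stage `n + 1` has at least `2 ^ n` vertices. Once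
two chains are distinct and have stopped jumping, the branching freezes their adjacency. The sampled
graphs therefore converge almost surely in the coupling, hence in distribution, and the limit is
invariant because the chains are i.i.d. (`IsTower.exists_limit`).

The limit graph satisfies every axiom. A finite tuple of its vertices has the pattern of its trace
in some late stage `n` with `φ (n + 1)` the axiom in question. A witness is found in the trace or
added at stage `n + 1`, and almost surely every vertex of a late stage is occupied by a chain that
never jumps again; that chain is the witness in the limit (`Run.exists_holds_limitGraph`). By
ultrahomogeneity and back-and-forth, a graph on `ℕ` satisfying the axioms is a copy of `G`
(`IsPithyAxiomatization.mem_isoClass_iff`).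

Trivial definable closure makes orbits over finite sets infinite (`infinite_orbit`), which supplies
the fresh witnesses and offshoots for the construction (`exists_run`). -/

noncomputable section

namespace ToyConstr

open FirstOrder.Language FirstOrder.Language.Structure

/-! ### Patterns of tuples and quantifier-free formulas -/

/-- The tuples `a` and `b` satisfy the same equalities and the same instances of the binary
relations `r` and `s`, respectively. -/
def SamePattern {M N ι : Type*} (r : M → M → Prop) (s : N → N → Prop) (a : ι → M) (b : ι → N) :
    Prop :=
  ∀ i j, (a i = a j ↔ b i = b j) ∧ (r (a i) (a j) ↔ s (b i) (b j))

namespace SamePattern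

variable {M N K ι κ : Type*} {r : M → M → Prop} {s : N → N → Prop} {t : K → K → Prop}
  {a : ι → M} {b : ι → N} {c : ι → K}

lemma refl (r : M → M → Prop) (a : ι → M) : SamePattern r r a a := fun _ _ => ⟨Iff.rfl, Iff.rfl⟩

lemma symm (h : SamePattern r s a b) : SamePattern s r b a :=
  fun i j => ⟨(h i j).1.symm, (h i j).2.symm⟩

lemma trans (h : SamePattern r s a b) (h' : SamePattern s t b c) : SamePattern r t a c :=
  fun i j => ⟨(h i j).1.trans (h' i j).1, (h i j).2.trans (h' i j).2⟩

lemma comp (h : SamePattern r s a b) (f : κ → ι) : SamePattern r s (a ∘ f) (b ∘ f) :=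
  fun i j => h (f i) (f j)

lemma of_snoc {n : ℕ} {a : Fin n → M} {b : Fin n → N} {x : M} {y : N}
    (h : SamePattern r s (Fin.snoc a x : Fin (n + 1) → M) (Fin.snoc b y : Fin (n + 1) → N)) :
    SamePattern r s a b := by
  have := h.comp Fin.castSucc
  simpa [Function.comp_def] using this

end SamePattern

/-- The adjacency relation of a structure in the language of graphs. -/
def adjRel (M : Type*) [Language.graph.Structure M] (x y : M) : Prop := RelMap adj ![x, y]

lemma exists_var_eq {α : Type*} (t : Language.graph.Term α) : ∃ x, t = Term.var x := by
  cases t with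
  | var x => exact ⟨x, rfl⟩
  | func f _ => exact f.elim

section Realize

variable {M N : Type*} [Language.graph.Structure M] [Language.graph.Structure N]

lemma relMap_adj {α : Type*} (R : Language.graph.Relations 2) (ts : Fin 2 → Language.graph.Term α)
    (v : α → M) :
    RelMap R (fun i => (ts i).realize v) ↔ adjRel M ((ts 0).realize v) ((ts 1).realize v) := by
  rw [Subsingleton.elim R adj, adjRel, iff_iff_eq]
  congr 1
  funext i
  fin_cases i <;> rfl

lemma relations_eq_two {n : ℕ} (R : Language.graph.Relations n) : n = 2 := by
  cases R; rfl

lemma realize_equal_iff_of_samePattern {α : Type*} {v : α → M} {w : α → N}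
    (h : SamePattern (adjRel M) (adjRel N) v w) (t u : Language.graph.Term α) :
    t.realize v = u.realize v ↔ t.realize w = u.realize w := by
  obtain ⟨x, rfl⟩ := exists_var_eq t
  obtain ⟨y, rfl⟩ := exists_var_eq u
  exact (h x y).1

lemma realize_rel_iff_of_samePattern {α : Type*} {v : α → M} {w : α → N}
    (h : SamePattern (adjRel M) (adjRel N) v w) {n : ℕ} (R : Language.graph.Relations n)
    (ts : Fin n → Language.graph.Term α) :
    RelMap R (fun i => (ts i).realize v) ↔ RelMap R (fun i => (ts i).realize w) := by
  obtain rfl := relations_eq_two R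
  rw [relMap_adj, relMap_adj]
  obtain ⟨x, hx⟩ := exists_var_eq (ts 0)
  obtain ⟨y, hy⟩ := exists_var_eq (ts 1)
  rw [hx, hy]
  exact (h x y).2

/-- The language has no function symbols, so terms are variables and an atomic formula is an
equality or an adjacency between two entries. -/
lemma realize_iff_of_samePattern {α : Type*} {n : ℕ} {ψ : Language.graph.BoundedFormula α n}
    (hψ : ψ.IsQF) {v : α → M} {w : α → N} {xs : Fin n → M} {ys : Fin n → N}
    (h : SamePattern (adjRel M) (adjRel N) (Sum.elim v xs) (Sum.elim w ys)) :
    ψ.Realize v xs ↔ ψ.Realize w ys := by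
  induction hψ with
  | falsum => exact Iff.rfl
  | of_isAtomic ha =>
    cases ha with
    | equal t u => simpa using realize_equal_iff_of_samePattern h t u
    | rel R ts => simpa using realize_rel_iff_of_samePattern h R ts
  | imp _ _ h₁ h₂ => simp only [BoundedFormula.realize_imp, h₁, h₂]

end Realize

lemma SamePattern.sumElim_default {M N : Type*} {n : ℕ} {r : M → M → Prop} {s : N → N → Prop}
    {xs : Fin n → M} {ys : Fin n → N}
    (h : SamePattern r s xs ys) :
    SamePattern r s (Sum.elim (default : Empty → M) xs) (Sum.elim (default : Empty → N) ys) := by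
  rintro (i | i) (j | j)
  · exact i.elim
  · exact i.elim
  · exact j.elim
  · exact h i j

/-- The formula that expresses that a tuple satisfies the same equalities and adjacencies as the
tuple `a`. -/
def diagramFormula {M : Type*} (r : M → M → Prop) {n : ℕ} (a : Fin n → M) :
    Language.graph.BoundedFormula Empty n :=
  open Classical in
  BoundedFormula.iInf fun p : Fin n × Fin n =>
    (if a p.1 = a p.2 then Term.bdEqual (&p.1) (&p.2)
      else (Term.bdEqual (&p.1) (&p.2)).not) ⊓
    (if r (a p.1) (a p.2) then adj.boundedFormula₂ (&p.1) (&p.2)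
      else (adj.boundedFormula₂ (&p.1) (&p.2)).not)

lemma isQF_iInf {L : Language} {α β : Type*} [Finite β] {n : ℕ} {f : β → L.BoundedFormula α n}
    (hf : ∀ b, (f b).IsQF) : (BoundedFormula.iInf f).IsQF := by
  have : ∀ l : List (L.BoundedFormula α n), (∀ ψ ∈ l, ψ.IsQF) →
      (l.foldr (· ⊓ ·) ⊤).IsQF := by
    intro l
    induction l with
    | nil => exact fun _ => BoundedFormula.IsQF.top
    | cons ψ l ih =>
      intro h
      exact (h ψ (by simp)).inf (ih fun χ hχ => h χ (by simp [hχ]))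
  apply this
  simp only [List.mem_map, forall_exists_index, and_imp]
  rintro _ b - rfl
  exact hf b

lemma isQF_diagramFormula {M : Type*} (r : M → M → Prop) {n : ℕ} (a : Fin n → M) :
    (diagramFormula r a).IsQF := by
  refine isQF_iInf fun p => BoundedFormula.IsQF.inf ?_ ?_
  · split_ifs
    · exact (BoundedFormula.IsAtomic.equal _ _).isQF
    · exact (BoundedFormula.IsAtomic.equal _ _).isQF.not
  · split_ifs
    · exact (BoundedFormula.IsAtomic.rel _ _).isQF
    · exact (BoundedFormula.IsAtomic.rel _ _).isQF.not

lemma realize_diagramFormula {M N : Type*} [Language.graph.Structure N] (r : M → M → Prop) {n : ℕ}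
    (a : Fin n → M) (b : Fin n → N) :
    (diagramFormula r a).Realize default b ↔ SamePattern r (adjRel N) a b := by
  rw [diagramFormula, BoundedFormula.realize_iInf, Prod.forall]
  refine forall_congr' fun i => forall_congr' fun j => ?_
  rw [BoundedFormula.realize_inf]
  refine and_congr ?_ ?_
  · by_cases h : a i = a j <;> simp [h]
  · by_cases h : r (a i) (a j) <;> simp [h, adjRel, BoundedFormula.realize_rel₂]

/-! ### Consequences of ultrahomogeneity and trivial definable closure -/

section Graph

variable {V : Type*} (G : SimpleGraph V)

lemma sameQFType_iff_samePattern {ι : Type*} {a b : ι → V} :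
    (letI := G.structure; SameQFType Language.graph a b) ↔ SamePattern G.Adj G.Adj a b := by
  let _ := G.structure
  constructor
  · intro h i j
    constructor
    · have := h (Term.equal (Term.var i) (Term.var j)) (BoundedFormula.IsAtomic.equal _ _).isQF
      simpa using this
    · have := h (adj.formula₂ (Term.var i) (Term.var j)) (BoundedFormula.IsAtomic.rel _ _).isQF
      rw [Formula.realize_rel₂, Formula.realize_rel₂] at this
      exact this
  · intro h ψ hψ
    refine realize_iff_of_samePattern hψ ?_
    rintro (i | i) (j | j)
    · exact h i j
    · exact j.elim0
    · exact i.elim0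
    · exact i.elim0

variable {G}

lemma holds_iff_of_samePattern {W : Type*} {F : SimpleGraph W} {φ : PithyMatrix} (hφ : φ.2.IsQF)
    {a : Fin φ.1 → V} {b : V} {a' : Fin φ.1 → W} {b' : W}
    (h : SamePattern G.Adj F.Adj (Fin.snoc a b : Fin (φ.1 + 1) → V)
      (Fin.snoc a' b' : Fin (φ.1 + 1) → W)) : φ.Holds G a b ↔ φ.Holds F a' b' := by
  let _ := G.structure
  let _ := F.structure
  exact realize_iff_of_samePattern hφ h.sumElim_default

/-- The structure `M` satisfies the sentence `(∀ x)(∃ y) φ(x, y)` iff the obvious condition holds. -/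
lemma realize_sentence_iff {M : Type*} [Language.graph.Structure M] (φ : PithyMatrix) :
    M ⊨ φ.sentence ↔ ∀ a : Fin φ.1 → M, ∃ b : M,
      φ.2.Realize default (Fin.snoc a b : Fin (φ.1 + 1) → M) := by
  rw [PithyMatrix.sentence, Sentence.Realize, BoundedFormula.realize_alls]
  simp only [BoundedFormula.realize_ex]

/-- Without function symbols the range of `a` is already a finitely generated substructure, and `a i
↦ b i` is a well-defined embedding of it. -/
lemma exists_iso_of_samePattern (hG : IsUltrahomogeneousGraph G) {ι : Type*} [Finite ι]
    {a b : ι → V} (h : SamePattern G.Adj G.Adj a b) : ∃ g : G ≃g G, ∀ i, g (a i) = b i := by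
  let _ := G.structure
  let S : Language.graph.Substructure V := ⟨Set.range a, fun f => f.elim⟩
  have hS : S.FG := by
    refine ⟨(Set.finite_range a).toFinset, ?_⟩
    apply le_antisymm
    · rw [Substructure.closure_le]
      rw [Set.Finite.coe_toFinset]
      exact subset_rfl
    · intro x hx
      exact Substructure.subset_closure ((Set.Finite.mem_toFinset _).2 hx)
  have hmem : ∀ x : S, ∃ i, a i = x := fun x => x.2
  choose k hk using hmem
  let f : S ↪[Language.graph] V :=
    { toFun := fun x => b (k x)
      inj' := by
        intro x y hxy
        apply Subtype.ext
        rw [← hk x, ← hk y]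
        exact (h _ _).1.2 hxy
      map_fun' := fun f => f.elim
      map_rel' := by
        intro n R x
        obtain rfl := relations_eq_two R
        rw [Subsingleton.elim R adj]
        change G.Adj (b (k (x 0))) (b (k (x 1))) ↔ G.Adj (x 0 : V) (x 1 : V)
        rw [← (h _ _).2, hk, hk] }
  obtain ⟨g, hg⟩ := hG S hS f
  refine ⟨⟨g.toEquiv, ?_⟩, ?_⟩
  · intro x y
    have := StrongHomClass.map_rel g adj ![x, y]
    exact this
  · intro i
    let x : S := ⟨a i, i, rfl⟩
    have h1 : f x = g x := by rw [hg]; rfl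
    have h2 : b (k x) = b i := ((h _ _).1.1 (hk x))
    exact h1.symm.trans h2

/-- If the orbit `O` of `b` over `X` were finite, `b` would be definable over the finite set `X ∪ (O
\ {b})`: an automorphism fixing that set cannot send `b` to another element of `O`, since that
element is already its own image. -/
lemma infinite_orbit (hdcl : HasTrivialDclGraph G) {X : Set V} (hX : X.Finite) {b : V}
    (hb : b ∉ X) : {c | ∃ g : G ≃g G, (∀ x ∈ X, g x = x) ∧ g b = c}.Infinite := by
  intro hfin
  let _ := G.structure
  set O := {c | ∃ g : G ≃g G, (∀ x ∈ X, g x = x) ∧ g b = c} with hO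
  have hbO : b ∈ O := ⟨RelIso.refl _, fun _ _ => rfl, rfl⟩
  have hmem : b ∈ definableClosure Language.graph V (X ∪ (O \ {b})) := by
    intro g hg
    let g' : G ≃g G := ⟨g.toEquiv, fun {x y} => StrongHomClass.map_rel g adj ![x, y]⟩
    have hg' : ∀ x, g' x = g x := fun _ => rfl
    by_contra hne
    have h1 : g b ∈ O := ⟨g', fun x hx => hg x (Or.inl hx), rfl⟩
    have h2 : g (g b) = g b := hg _ (Or.inr ⟨h1, hne⟩)
    exact hne (g.injective h2)
  rw [hdcl _ (hX.union hfin.sdiff)] at hmem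
  rcases hmem with h | h
  · exact hb h
  · exact h.2 rfl

end Graph

/-! ### Back-and-forth -/

/-- Every finite tuple correspondence that preserves the pattern can be extended by any element of
the first structure. -/
def Extends {M N : Type*} (r : M → M → Prop) (s : N → N → Prop) : Prop :=
  ∀ (n : ℕ) (a : Fin n → M) (b : Fin n → N), SamePattern r s a b → ∀ c : M, ∃ d : N,
    SamePattern r s (Fin.snoc a c : Fin (n + 1) → M) (Fin.snoc b d : Fin (n + 1) → N)

section BackAndForth

variable {M N : Type*} {r : M → M → Prop} {s : N → N → Prop}

/-- A finite set of pairs that is the graph of a partial isomorphism. -/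
def IsPartialIso (r : M → M → Prop) (s : N → N → Prop) (f : Finset (M × N)) : Prop :=
  SamePattern r s (fun p : f => p.1.1) (fun p : f => p.1.2)

lemma IsPartialIso.exists_insert [DecidableEq (M × N)] (h : Extends r s) {f : Finset (M × N)}
    (hf : IsPartialIso r s f) (c : M) : ∃ d, IsPartialIso r s (insert (c, d) f) := by
  obtain ⟨d, hd⟩ := h _ _ _ (hf.comp f.equivFin.symm) c
  refine ⟨d, ?_⟩
  have key : ∀ p : (insert (c, d) f : Finset (M × N)), ∃ i : Fin (f.card + 1),
      (Fin.snoc ((fun p : f => p.1.1) ∘ f.equivFin.symm) c : Fin (f.card + 1) → M) i = p.1.1 ∧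
      (Fin.snoc ((fun p : f => p.1.2) ∘ f.equivFin.symm) d : Fin (f.card + 1) → N) i = p.1.2 := by
    rintro ⟨p, hp⟩
    rcases Finset.mem_insert.1 hp with rfl | hp
    · exact ⟨Fin.last _, by simp⟩
    · exact ⟨(f.equivFin ⟨p, hp⟩).castSucc, by simp⟩
  choose k hk₁ hk₂ using key
  intro p q
  have := hd (k p) (k q)
  rwa [hk₁, hk₁, hk₂, hk₂] at this

lemma IsPartialIso.swap {f : Finset (M × N)} [DecidableEq (N × M)] (hf : IsPartialIso r s f) :
    IsPartialIso s r (f.image Prod.swap) := by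
  have key : ∀ p : (f.image Prod.swap : Finset (N × M)), p.1.swap ∈ f := by
    rintro ⟨p, hp⟩
    obtain ⟨q, hq, rfl⟩ := Finset.mem_image.1 hp
    simpa using hq
  exact hf.symm.comp fun p : (f.image Prod.swap : Finset (N × M)) => (⟨p.1.swap, key p⟩ : f)

/-- Countable structures that satisfy the back-and-forth property are isomorphic. -/
lemma exists_equiv_of_extends [Countable M] [Countable N] (h : Extends r s) (h' : Extends s r) :
    ∃ e : M ≃ N, ∀ x y, r x y ↔ s (e x) (e y) := by
  classical
  let P := {f : Finset (M × N) // IsPartialIso r s f}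
  let bot : P := ⟨∅, fun i => absurd i.2 (Finset.notMem_empty _)⟩
  -- The forth and back requirements, one for each element of either structure. There are countably
  -- many, so some directed family of finite partial isomorphisms meets them all, and its union is
  -- the isomorphism.
  let D : M ⊕ N → Order.Cofinal P := fun x =>
    match x with
    | .inl c =>
      { carrier := {f | ∃ d, (c, d) ∈ f.1}
        isCofinal := fun f => by
          obtain ⟨d, hd⟩ := f.2.exists_insert h c
          exact ⟨⟨_, hd⟩, ⟨d, Finset.mem_insert_self _ _⟩, Finset.subset_insert _ _⟩ }
    | .inr d =>
      { carrier := {f | ∃ c, (c, d) ∈ f.1}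
        isCofinal := fun f => by
          obtain ⟨c, hc⟩ := f.2.swap.exists_insert h' d
          refine ⟨⟨_, hc.swap⟩, ⟨c, ?_⟩, ?_⟩
          · simp
          · intro p hp
            simp only [Finset.mem_image, Finset.mem_insert]
            exact ⟨p.swap, Or.inr ⟨p, hp, rfl⟩, by simp⟩ }
  let _ : Encodable (M ⊕ N) := Encodable.ofCountable _
  let I := Order.idealOfCofinals bot D
  have hD : ∀ x, ∃ f, f ∈ D x ∧ f ∈ I := fun x => Order.cofinal_meets_idealOfCofinals bot D x
  have h1 : ∀ c : M, ∃ d : N, ∃ f ∈ I, (c, d) ∈ f.1 := fun c => by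
    obtain ⟨f, ⟨d, hd⟩, hf⟩ := hD (.inl c)
    exact ⟨d, f, hf, hd⟩
  have h2 : ∀ d : N, ∃ c : M, ∃ f ∈ I, (c, d) ∈ f.1 := fun d => by
    obtain ⟨f, ⟨c, hc⟩, hf⟩ := hD (.inr d)
    exact ⟨c, f, hf, hc⟩
  have key : ∀ {c d c' d'}, (∃ f ∈ I, (c, d) ∈ f.1) → (∃ f ∈ I, (c', d') ∈ f.1) →
      (c = c' ↔ d = d') ∧ (r c c' ↔ s d d') := by
    rintro c d c' d' ⟨f, hf, hcd⟩ ⟨f', hf', hcd'⟩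
    obtain ⟨g, -, hfg, hfg'⟩ := I.directed _ hf _ hf'
    exact g.2 ⟨_, hfg hcd⟩ ⟨_, hfg' hcd'⟩
  choose F hF using h1
  choose F' hF' using h2
  refine ⟨⟨F, F', fun c => ?_, fun d => ?_⟩, fun x y => ?_⟩
  · exact (key (hF' (F c)) (hF c)).1.2 rfl
  · exact (key (hF (F' d)) (hF' d)).1.1 rfl
  · exact (key (hF x) (hF y)).2

/-- Structures that satisfy the back-and-forth property are elementarily equivalent. -/
lemma realize_iff_of_extends [Language.graph.Structure M] [Language.graph.Structure N]
    (h : Extends (adjRel M) (adjRel N)) (h' : Extends (adjRel N) (adjRel M)) {n : ℕ}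
    (ψ : Language.graph.BoundedFormula Empty n) {a : Fin n → M} {b : Fin n → N}
    (hab : SamePattern (adjRel M) (adjRel N) a b) :
    ψ.Realize default a ↔ ψ.Realize default b := by
  induction ψ with
  | falsum => exact Iff.rfl
  | equal t u => exact realize_equal_iff_of_samePattern hab.sumElim_default t u
  | rel R ts => exact realize_rel_iff_of_samePattern hab.sumElim_default R ts
  | imp ψ₁ ψ₂ ih₁ ih₂ => simp only [BoundedFormula.realize_imp, ih₁ hab, ih₂ hab]
  | all ψ ih =>
    simp only [BoundedFormula.realize_all]
    constructor
    · intro hM y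
      obtain ⟨x, hx⟩ := h' _ _ _ hab.symm y
      exact (ih hx.symm).1 (hM x)
    · intro hN x
      obtain ⟨y, hy⟩ := h _ _ _ hab x
      exact (ih hy).2 (hN y)

end BackAndForth

/-! ### Axiomatizations by `∀∃`-sentences and their countable models -/

section Axioms

variable {V : Type*} {G : SimpleGraph V}

/-- Each quantifier-free matrix whose `∀∃`-sentence holds in `G` has its sentence true in `N`. -/
def SatisfiesPithyTheory (G : SimpleGraph V) (N : Type*) [Language.graph.Structure N] : Prop :=
  ∀ φ : PithyMatrix, φ.2.IsQF → (letI := G.structure; V ⊨ φ.sentence) → N ⊨ φ.sentence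

/-- The matrix of the extension axiom: if `x` has the pattern of `a`, then `(x, y)` has the pattern
of `(a, c)`. -/
def extensionMatrix (r : V → V → Prop) {n : ℕ} (a : Fin n → V) (c : V) : PithyMatrix :=
  -- No variable has index `n` or more, so lifting renames nothing and only makes `y` available as a
  -- dummy variable.
  ⟨n, ((diagramFormula r a).liftAt 1 n).imp (diagramFormula r (Fin.snoc a c : Fin (n + 1) → V))⟩

/-- The matrix that expresses that `x` does not have the pattern of `b`. -/
def omissionMatrix {N : Type*} (s : N → N → Prop) {n : ℕ} (b : Fin n → N) : PithyMatrix :=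
  ⟨n, (diagramFormula s b).not.liftAt 1 n⟩

lemma snoc_comp_castSucc {K : Type*} {n : ℕ} (x : Fin n → K) (y : K) :
    (Fin.snoc x y : Fin (n + 1) → K) ∘ Fin.castSucc = x := by
  funext i
  simp

lemma realize_extensionMatrix {K : Type*} [Language.graph.Structure K] (r : V → V → Prop) {n : ℕ}
    (a : Fin n → V) (c : V) [Nonempty K] :
    K ⊨ (extensionMatrix r a c).sentence ↔ ∀ x : Fin n → K, SamePattern r (adjRel K) a x →
      ∃ y, SamePattern r (adjRel K) (Fin.snoc a c : Fin (n + 1) → V)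
        (Fin.snoc x y : Fin (n + 1) → K) := by
  rw [realize_sentence_iff]
  refine forall_congr' fun x => ?_
  have : ∀ y : K, (extensionMatrix r a c).2.Realize default (Fin.snoc x y : Fin (n + 1) → K) ↔
      (SamePattern r (adjRel K) a x → SamePattern r (adjRel K)
        (Fin.snoc a c : Fin (n + 1) → V) (Fin.snoc x y : Fin (n + 1) → K)) := fun y => by
    refine BoundedFormula.realize_imp.trans (imp_congr
      (BoundedFormula.realize_liftAt_one_self.trans ?_) (realize_diagramFormula _ _ _))
    rw [realize_diagramFormula]
    exact iff_of_eq (congrArg _ (snoc_comp_castSucc x y))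
  refine (exists_congr this).trans ?_
  by_cases h : SamePattern r (adjRel K) a x
  · simp only [h, true_imp_iff]
  · simp only [h, false_imp_iff, exists_const]

lemma realize_omissionMatrix {K N : Type*} [Language.graph.Structure K] [Nonempty K]
    (s : N → N → Prop) {n : ℕ} (b : Fin n → N) :
    K ⊨ (omissionMatrix s b).sentence ↔ ∀ x : Fin n → K, ¬ SamePattern s (adjRel K) b x := by
  rw [realize_sentence_iff]
  refine forall_congr' fun x => ?_
  have : ∀ y : K, (omissionMatrix s b).2.Realize default (Fin.snoc x y : Fin (n + 1) → K) ↔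
      ¬ SamePattern s (adjRel K) b x := fun y => by
    refine BoundedFormula.realize_liftAt_one_self.trans (BoundedFormula.realize_not.trans ?_)
    rw [realize_diagramFormula]
    exact not_congr (iff_of_eq (congrArg _ (snoc_comp_castSucc x y)))
  exact (exists_congr this).trans (exists_const K)

/-- The extension axiom for `(a, c)` holds in `G`: an automorphism taking `a` to another tuple of
the same pattern carries `c` along. -/
lemma SatisfiesPithyTheory.extends (hG : IsUltrahomogeneousGraph G) {N : Type*}
    [Language.graph.Structure N] [Nonempty N] (hN : SatisfiesPithyTheory G N) :
    Extends G.Adj (adjRel N) := by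
  intro n a b hab c
  have : Nonempty V := ⟨c⟩
  refine (realize_extensionMatrix G.Adj a c).1 (hN (extensionMatrix G.Adj a c)
    (isQF_diagramFormula _ _ |>.liftAt.imp (isQF_diagramFormula _ _)) ?_) b hab
  let _ := G.structure
  refine (realize_extensionMatrix G.Adj a c).2 fun x hx => ?_
  obtain ⟨g, hg⟩ := exists_iso_of_samePattern hG hx
  refine ⟨g c, ?_⟩
  have : (Fin.snoc x (g c) : Fin (n + 1) → V) = g ∘ (Fin.snoc a c : Fin (n + 1) → V) := by
    rw [Fin.comp_snoc, show g ∘ a = x from funext hg]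
  rw [this]
  exact fun i j => ⟨g.injective.eq_iff.symm, g.map_adj_iff.symm⟩

/-- The pattern of `(b, d)` must occur somewhere in `G`, since otherwise the axiom omitting it would
hold in `N` too. Ultrahomogeneity then moves an occurrence so that its initial part lies on `a`. -/
lemma SatisfiesPithyTheory.extends_symm [Nonempty V] (hG : IsUltrahomogeneousGraph G) {N : Type*}
    [Language.graph.Structure N] [Nonempty N] (hN : SatisfiesPithyTheory G N) :
    Extends (adjRel N) G.Adj := by
  intro n b a hab d
  obtain ⟨x, hx⟩ : ∃ x : Fin (n + 1) → V,
      SamePattern (adjRel N) G.Adj (Fin.snoc b d : Fin (n + 1) → N) x := by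
    by_contra! hno
    let _ := G.structure
    exact (realize_omissionMatrix (adjRel N) _).1 (hN (omissionMatrix (adjRel N) _)
      ((isQF_diagramFormula _ _).not.liftAt) ((realize_omissionMatrix (adjRel N) _).2 hno)) _
      (SamePattern.refl _ _)
  rw [← Fin.snoc_init_self x] at hx
  obtain ⟨g, hg⟩ := exists_iso_of_samePattern hG (hx.of_snoc.symm.trans hab)
  refine ⟨g (x (Fin.last n)), ?_⟩
  have : (Fin.snoc a (g (x (Fin.last n))) : Fin (n + 1) → V) =
      g ∘ (Fin.snoc (Fin.init x) (x (Fin.last n)) : Fin (n + 1) → V) := by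
    rw [Fin.comp_snoc, show g ∘ (Fin.init x) = a from funext hg]
  rw [this]
  exact hx.trans fun i j => ⟨g.injective.eq_iff.symm, g.map_adj_iff.symm⟩

instance : Countable PithyMatrix := by
  have : IsEmpty (Σ n, Language.graph.Functions n) := ⟨fun f => f.2.elim⟩
  have : Countable (Σ n, Language.graph.Relations n) := by
    refine Function.Injective.countable (f := Sigma.fst) ?_
    rintro ⟨n, R⟩ ⟨m, S⟩ (rfl : n = m)
    rw [Subsingleton.elim R S]
  have : Countable Language.graph.Symbols := instCountableSum
  refine Function.Injective.countable
    (f := fun φ : PithyMatrix => (⟨φ.1 + 1, φ.2⟩ : Σ n, Language.graph.BoundedFormula Empty n)) ?_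
  rintro ⟨n, φ⟩ ⟨m, ψ⟩ h
  obtain rfl : n = m := Nat.succ_injective (congrArg Sigma.fst h)
  simpa using h

/-- An ultrahomogeneous graph has an axiomatization by `∀∃`-sentences with one existential
quantifier, each listed infinitely often. -/
lemma exists_isPithyAxiomatization [Nonempty V] (hG : IsUltrahomogeneousGraph G) :
    ∃ φ : ℕ → PithyMatrix, IsPithyAxiomatization G φ := by
  let _ := G.structure
  let Φ := {φ : PithyMatrix // φ.2.IsQF ∧ V ⊨ φ.sentence}
  have : Nonempty Φ := ⟨⟨0, ⊤⟩, BoundedFormula.IsQF.top, by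
    rw [realize_sentence_iff]
    simp⟩
  obtain ⟨e, he⟩ := exists_surjective_nat Φ
  -- All true sentences of the required form are listed; the second component of the unpaired index
  -- is ignored, which repeats each one infinitely often.
  refine ⟨fun i => (e i.unpair.1).1, fun i => (e _).2.1, fun i => ?_, fun ψ => ?_⟩
  · refine Set.infinite_of_injective_forall_mem (f := fun k => Nat.pair i.unpair.1 k) ?_ ?_
    · intro k l hkl
      exact (Nat.pair_eq_pair.1 hkl).2
    · intro k
      simp
  · have hV : V ⊨ (Set.range fun i => (e (Nat.unpair i).1).1.sentence : Language.graph.Theory) := by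
      rw [Theory.model_iff]
      rintro _ ⟨i, rfl⟩
      exact (e _).2.2
    constructor
    · intro hψ N
      have hN : SatisfiesPithyTheory G N := fun φ h₁ h₂ => by
        obtain ⟨k, hk⟩ := he ⟨φ, h₁, h₂⟩
        refine N.is_model.realize_of_mem _ ⟨Nat.pair k 0, ?_⟩
        simp [hk]
      intro v xs
      rw [Subsingleton.elim v default]
      exact (realize_iff_of_extends (hN.extends hG) (hN.extends_symm hG) ψ
        (fun i => i.elim0)).1 hψ
    · intro hψ
      exact hψ.realize_sentence V

lemma IsPithyAxiomatization.realize_sentence {φ : ℕ → PithyMatrix}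
    (hφ : IsPithyAxiomatization G φ) (i : ℕ) : letI := G.structure; V ⊨ (φ i).sentence := by
  let _ := G.structure
  refine (hφ.axiomatizes _).2 fun M v xs => ?_
  rw [Subsingleton.elim v default, Subsingleton.elim xs default]
  exact M.is_model.realize_of_mem _ ⟨i, rfl⟩

lemma IsPithyAxiomatization.exists_holds {φ : ℕ → PithyMatrix}
    (hφ : IsPithyAxiomatization G φ) (i : ℕ) (a : Fin (φ i).1 → V) : ∃ b, (φ i).Holds G a b := by
  let _ := G.structure
  exact (realize_sentence_iff _).1 (hφ.realize_sentence i) a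

/-- The countable models of the axioms are exactly the copies of `G`. -/
lemma IsPithyAxiomatization.mem_isoClass_iff [Nonempty V] [Countable V]
    {φ : ℕ → PithyMatrix} (hφ : IsPithyAxiomatization G φ) (hG : IsUltrahomogeneousGraph G)
    {H : SimpleGraph ℕ} :
    H ∈ isoClass G ↔ ∀ i, ∀ a : Fin (φ i).1 → ℕ, ∃ b, (φ i).Holds H a b := by
  constructor
  · rintro ⟨e⟩ i a
    obtain ⟨b, hb⟩ := hφ.exists_holds i (e ∘ a)
    refine ⟨e.symm b, (holds_iff_of_samePattern (hφ.isQF i) ?_).2 hb⟩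
    have : (Fin.snoc (e ∘ a) b : Fin ((φ i).1 + 1) → V) =
        e ∘ (Fin.snoc a (e.symm b) : Fin ((φ i).1 + 1) → ℕ) := by
      rw [Fin.comp_snoc, e.apply_symm_apply]
    rw [this]
    exact fun i j => ⟨e.injective.eq_iff.symm, e.map_adj_iff.symm⟩
  · intro h
    let _ := G.structure
    let _ := H.structure
    have hH : ℕ ⊨ (Set.range fun i => (φ i).sentence : Language.graph.Theory) := by
      rw [Theory.model_iff]
      rintro _ ⟨i, rfl⟩
      exact (realize_sentence_iff _).2 (h i)
    -- The given axioms need not include the extension and omission axioms, but they entail every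
    -- sentence true in `G`.
    have hN : SatisfiesPithyTheory G ℕ := fun ψ _ hψ =>
      ((hφ.axiomatizes _).1 hψ).realize_sentence ℕ
    obtain ⟨e, he⟩ := exists_equiv_of_extends (hN.extends_symm hG) (hN.extends hG)
    exact ⟨⟨e, fun {x y} => (he x y).symm⟩⟩

end Axioms

/-! ### Carrying out the construction -/

section Existence

variable {V : Type*} {G : SimpleGraph V}

lemma isBranching_iff {A : Finset V} {S : V → Finset V} :
    IsBranching G A S ↔ (∀ s ∈ A, s ∈ S s) ∧
      ∀ f : V → V, (∀ s ∈ A, f s ∈ S s) →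
        ∀ s ∈ A, ∀ t ∈ A, (s = t ↔ f s = f t) ∧ (G.Adj s t ↔ G.Adj (f s) (f t)) := by
  refine and_congr_right fun hS => ?_
  simp only [sameQFType_iff_samePattern]
  constructor
  · intro h f hf s hs t ht
    have := h (fun s => f s) (fun s => hf s s.2) ⟨s, hs⟩ ⟨t, ht⟩
    simpa using this
  · classical
    intro h f hf s t
    have := h (fun s => if hs : s ∈ A then f ⟨s, hs⟩ else s)
      (fun s hs => by simpa [hs] using hf ⟨s, hs⟩) s s.2 t t.2
    simpa using this

/-- The vertices of `U` are branched one at a time. The offshoots of `u` come from its orbit over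
the set `X` of all offshoots of the other vertices. A choice of offshoots is then the image, under
an automorphism fixing `X`, of the choice with `u` put back, to which the induction hypothesis
applies. -/
lemma exists_branching_of_subset (hdcl : HasTrivialDclGraph G) (A : Finset V) {m : ℕ} (hm : 1 ≤ m)
    (U : Finset V) : U ⊆ A → ∃ S : V → Finset V,
      IsBranching G A S ∧ (∀ s ∈ U, (S s).card = m) ∧ ∀ s ∉ U, S s = {s} := by
  classical
  simp only [isBranching_iff]
  induction U using Finset.induction_on with
  | empty =>
    intro _
    refine ⟨fun s => {s}, ⟨by simp, fun f hf s hs t ht => ?_⟩, by simp, by simp⟩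
    simp only [Finset.mem_singleton] at hf
    simp [hf s hs, hf t ht]
  | insert u U hu ih =>
    intro hUA
    obtain ⟨S, ⟨hS₁, hS₂⟩, hS₃, hS₄⟩ := ih ((Finset.subset_insert _ _).trans hUA)
    have huA : u ∈ A := hUA (Finset.mem_insert_self _ _)
    let X : Finset V := (A.erase u).biUnion S
    -- If `u` were an offshoot of some `s ≠ u`, replacing `s` by `u` and keeping `u` would identify
    -- two distinct entries.
    have huX : u ∉ (X : Set V) := by
      intro h
      obtain ⟨s, hs, hus⟩ := Finset.mem_biUnion.1 (Finset.mem_coe.1 h)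
      obtain ⟨hsu, hsA⟩ := Finset.mem_erase.1 hs
      have := (hS₂ (Function.update id s u) (fun t ht => by
        rcases eq_or_ne t s with rfl | hts
        · simpa using hus
        · simpa [hts] using hS₁ t ht) s hsA u huA).1.2 (by simp [hsu.symm])
      exact hsu this
    have hinf := (infinite_orbit hdcl X.finite_toSet huX).sdiff (Set.finite_singleton u)
    obtain ⟨O, hO, hOcard⟩ := hinf.exists_subset_card_eq (m - 1)
    have huO : u ∉ O := fun h => (hO h).2 rfl
    refine ⟨Function.update S u (insert u O), ⟨fun s hs => ?_, fun f hf => ?_⟩, fun s hs => ?_,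
      fun s hs => ?_⟩
    · rcases eq_or_ne s u with rfl | hsu
      · simp
      · simpa [hsu] using hS₁ s hs
    · obtain ⟨g, hgX, hgu⟩ : ∃ g : G ≃g G, (∀ x ∈ (X : Set V), g x = x) ∧ g u = f u := by
        have := hf u huA
        rw [Function.update_self, Finset.mem_insert] at this
        rcases this with h | h
        · exact ⟨RelIso.refl _, fun _ _ => rfl, h.symm⟩
        · exact (hO h).1
      have hf0 : ∀ s ∈ A, Function.update f u u s ∈ S s := fun s hs => by
        rcases eq_or_ne s u with rfl | hsu
        · simpa using hS₁ s hs
        · simpa [hsu] using hf s hs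
      have hg : ∀ s ∈ A, f s = g (Function.update f u u s) := fun s hs => by
        rcases eq_or_ne s u with rfl | hsu
        · simpa using hgu.symm
        · have h1 : f s ∈ S s := by simpa [hsu] using hf s hs
          rw [Function.update_of_ne hsu, hgX]
          exact Finset.mem_coe.2 (Finset.mem_biUnion.2 ⟨s, Finset.mem_erase.2 ⟨hsu, hs⟩, h1⟩)
      intro s hs t ht
      rw [hg s hs, hg t ht, g.injective.eq_iff, g.map_adj_iff]
      exact hS₂ _ hf0 s hs t ht
    · rcases eq_or_ne s u with rfl | hsu
      · rw [Function.update_self, Finset.card_insert_of_notMem huO, hOcard]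
        omega
      · rw [Function.update_of_ne hsu]
        exact hS₃ s (Finset.mem_of_mem_insert_of_ne hs hsu)
    · rw [Finset.mem_insert, not_or] at hs
      rw [Function.update_of_ne hs.1]
      exact hS₄ s hs.2

lemma exists_branching [Infinite V] (hdcl : HasTrivialDclGraph G) (A T : Finset V) {m : ℕ}
    (hm : 1 ≤ m) : ∃ S : V → Finset V,
      IsBranching G A S ∧ (∀ s ∈ T, (S s).card = m) ∧ ∀ s ∈ A, s ∉ T → S s = {s} := by
  classical
  obtain ⟨S, hS₁, hS₂, hS₃⟩ := exists_branching_of_subset hdcl A hm (A ∩ T) Finset.inter_subset_left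
  -- The cardinality condition ranges over all of `T`, so vertices of `T` outside `A` receive an
  -- arbitrary set of size `m`.
  obtain ⟨O, hO⟩ := Infinite.exists_subset_card_eq V m
  rw [isBranching_iff] at hS₁
  refine ⟨fun s => if s ∈ A then S s else O, isBranching_iff.2 ⟨fun s hs => ?_, fun f hf => ?_⟩,
    fun s hs => ?_, fun s hs hsT => ?_⟩
  · simpa [hs] using hS₁.1 s hs
  · exact hS₁.2 f fun s hs => by simpa [hs] using hf s hs
  · by_cases h : s ∈ A
    · simpa [h] using hS₂ s (Finset.mem_inter.2 ⟨h, hs⟩)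
    · simpa [h] using hO
  · simpa [hs] using hS₃ s (by simp [hsT])

lemma exists_injOn_of_infinite [Nonempty V] {ι : Type*} {T : Set ι} (hT : T.Finite) {P : ι → Set V}
    (hP : ∀ i ∈ T, (P i).Infinite) : ∃ d : ι → V, Set.InjOn d T ∧ ∀ i ∈ T, d i ∈ P i := by
  classical
  induction T, hT using Set.Finite.induction_on with
  | empty =>
    exact ⟨fun _ => Classical.arbitrary V, by simp, by simp⟩
  | @insert i T hi hT ih =>
    obtain ⟨d, hd₁, hd₂⟩ := ih fun j hj => hP j (Or.inr hj)
    obtain ⟨x, hx, hxT⟩ := ((hP i (Or.inl rfl)).sdiff (hT.image d)).nonempty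
    have hne : ∀ j ∈ T, j ≠ i := fun j hj h => hi (h ▸ hj)
    have hup : Set.EqOn (Function.update d i x) d T := fun j hj =>
      Function.update_of_ne (hne j hj) _ _
    refine ⟨Function.update d i x, ?_, ?_⟩
    · rw [Set.injOn_insert hi, hup.injOn_iff, hup.image_eq, Function.update_self]
      exact ⟨hd₁, hxT⟩
    · rintro j (rfl | hj)
      · rwa [Function.update_self]
      · rw [hup hj]
        exact hd₂ j hj

lemma finite_needsWitness (φ : PithyMatrix) (X : Finset V) : (needsWitness G φ X).Finite := by
  refine (Set.Finite.pi fun _ : Fin φ.1 => X.finite_toSet).subset ?_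
  intro a ha i _
  exact ha.1 i

/-- When no entry of `a` is a witness, any witness lies outside the range of `a`, and its infinite
orbit over that range consists of witnesses. Distinct ones can thus be picked for finitely many
tuples, avoiding `X`. -/
lemma exists_isNewSlice [Infinite V] (hdcl : HasTrivialDclGraph G)
    {φ : PithyMatrix} (hφ : φ.2.IsQF) (hφG : ∀ a, ∃ b, φ.Holds G a b) (X : Finset V) :
    ∃ B, IsNewSlice G φ X B := by
  classical
  rcases (needsWitness G φ X).eq_empty_or_nonempty with h | h
  · obtain ⟨b, hb⟩ := Infinite.exists_notMem_finset X
    exact ⟨{b}, Or.inr ⟨h, b, hb, rfl⟩⟩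
  · have hinf : ∀ a ∈ needsWitness G φ X, ({b | φ.Holds G a b} \ (X : Set V)).Infinite := by
      intro a ha
      obtain ⟨b, hb⟩ := hφG a
      have hba : b ∉ Set.range a := by
        rintro ⟨i, rfl⟩
        exact ha.2 ⟨i, hb⟩
      refine ((infinite_orbit hdcl (Set.finite_range a) hba).mono ?_).sdiff X.finite_toSet
      rintro _ ⟨g, hg, rfl⟩
      refine (holds_iff_of_samePattern hφ ?_).1 hb
      have : (Fin.snoc a (g b) : Fin (φ.1 + 1) → V) =
          g ∘ (Fin.snoc a b : Fin (φ.1 + 1) → V) := by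
        rw [Fin.comp_snoc, show g ∘ a = a from funext fun i => hg _ ⟨i, rfl⟩]
      rw [this]
      exact fun i j => ⟨g.injective.eq_iff.symm, g.map_adj_iff.symm⟩
    obtain ⟨d, hd₁, hd₂⟩ := exists_injOn_of_infinite (finite_needsWitness φ X) hinf
    refine ⟨((finite_needsWitness φ X).image d).toFinset, Or.inl ⟨h, d, hd₁, fun a ha =>
      ⟨(hd₂ a ha).2, (hd₂ a ha).1⟩, Set.Finite.coe_toFinset _⟩⟩

lemma IsNewSlice.nonempty {φ : PithyMatrix} {X B : Finset V} (h : IsNewSlice G φ X B) :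
    B.Nonempty := by
  rcases h with ⟨h, d, -, -, hB⟩ | ⟨-, b, -, rfl⟩
  · rw [← Finset.coe_nonempty, hB]
    exact h.image d
  · exact Finset.singleton_nonempty b

/-- The construction can be carried out from any finite nonempty set of vertices. -/
lemma exists_run [Infinite V] (hdcl : HasTrivialDclGraph G) {φ : ℕ → PithyMatrix}
    (hφ : IsPithyAxiomatization G φ) {X₀ : Finset V} (hX₀ : X₀.Nonempty) :
    ∃ R : Run G φ, R.stage 0 0 = X₀ := by
  classical
  choose B hB using fun n => exists_isNewSlice hdcl (hφ.isQF n) (hφ.exists_holds n)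
  have hpos : ∀ n X, 1 ≤ 2 ^ n * (B (n + 1) X).card := fun n X =>
    Nat.mul_pos (by positivity) (hB _ _).nonempty.card_pos
  choose S hS₁ hS₂ hS₃ using fun n X A T => exists_branching hdcl A T (hpos n X)
  let nextStage (n : ℕ) (X : Finset V) (sl : ℕ → Finset V) (k : ℕ) : Finset V :=
    Nat.rec (X ∪ B (n + 1) X) (fun k A => A.biUnion (S n X A (sl (n - k)))) k
  -- The state consists of the substages and slices of stage `n`. Slice `i` branches when passing
  -- from substage `n - i` to the next, hence that argument of `nextStage` below.
  let state (n : ℕ) : (ℕ → Finset V) × (ℕ → Finset V) :=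
    Nat.rec (fun _ => X₀, fun _ => X₀) (fun n st =>
      (nextStage n (st.1 n) st.2, fun i => if i = n + 1 then B (n + 1) (st.1 n) else
        (st.2 i).biUnion (S n (st.1 n) (nextStage n (st.1 n) st.2 (n - i)) (st.2 i)))) n
  refine ⟨⟨fun n => (state n).1, fun n => (state n).2, hX₀, rfl, fun n => ?_, fun n => ?_,
    fun n k hk => ?_⟩, rfl⟩
  · have : (state (n + 1)).2 (n + 1) = B (n + 1) ((state n).1 n) := if_pos rfl
    rw [this]
    exact hB _ _
  · have : (state (n + 1)).2 (n + 1) = B (n + 1) ((state n).1 n) := if_pos rfl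
    rw [this]
    exact Finset.coe_union _ _
  · have h1 : (state (n + 1)).2 (n + 1) = B (n + 1) ((state n).1 n) := if_pos rfl
    have h2 : (state (n + 1)).2 (n - k) = ((state n).2 (n - k)).biUnion
        (S n ((state n).1 n) ((state (n + 1)).1 k) ((state n).2 (n - k))) := by
      refine (if_neg (by omega)).trans ?_
      rw [Nat.sub_sub_self hk]
    refine ⟨S n ((state n).1 n) ((state (n + 1)).1 k) ((state n).2 (n - k)), hS₁ _ _ _ _, ?_,
      hS₃ _ _ _ _, ?_, ?_⟩
    · rw [h1]
      exact hS₂ _ _ _ _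
    · exact Finset.coe_biUnion
    · rw [h2]
      exact Finset.coe_biUnion

end Existence

/-! ### Parents of vertices and the partition into slices -/

section Parent

variable {V : Type*} {G : SimpleGraph V} {φ : ℕ → PithyMatrix}

lemma IsBranching.ne_and_adj_iff {A : Finset V} {S : V → Finset V} (h : IsBranching G A S)
    {s t x y : V} (hs : s ∈ A) (ht : t ∈ A) (hx : x ∈ S s) (hy : y ∈ S t) (hst : s ≠ t) :
    x ≠ y ∧ (G.Adj x y ↔ G.Adj s t) := by
  classical
  rw [isBranching_iff] at h
  have := h.2 (Function.update (Function.update id s x) t y) (fun u hu => by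
    rcases eq_or_ne u t with rfl | hut
    · simpa using hy
    · rcases eq_or_ne u s with rfl | hus
      · simpa [hut] using hx
      · simpa [hut, hus] using h.1 u hu) s hs t ht
  rw [Function.update_self, Function.update_of_ne hst, Function.update_self] at this
  exact ⟨fun hxy => hst (this.1.2 hxy), this.2.symm⟩

namespace Run

variable (R : Run G φ)

/-- The slices of stage `n` partition its vertex set. -/
def SlicesPartition (n : ℕ) : Prop :=
  (∀ x, x ∈ R.stage n n ↔ ∃ i ≤ n, x ∈ R.slice n i) ∧
    ∀ i ≤ n, ∀ j ≤ n, ∀ x, x ∈ R.slice n i → x ∈ R.slice n j → i = j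

/-- The map `p` sends each vertex of substage `(n + 1, k)` to the vertex of substage `(n + 1, 0)`
that it is an offshoot of, or that it is equal to. -/
structure IsParentMap (n k : ℕ) (p : V → V) : Prop where
  mem : ∀ x ∈ R.stage (n + 1) k, p x ∈ R.stage (n + 1) 0
  adj_iff : ∀ x ∈ R.stage (n + 1) k, ∀ y ∈ R.stage (n + 1) k, p x ≠ p y →
    (G.Adj x y ↔ G.Adj (p x) (p y))
  card_fiber : ∀ j ≤ n, n - j < k → ∀ w ∈ R.slice n j,
    {x | x ∈ R.stage (n + 1) k ∧ p x = w}.ncard = 2 ^ n * (R.slice (n + 1) (n + 1)).card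
  mem_slice_iff : ∀ j ≤ n, n - j < k → ∀ x, x ∈ R.slice (n + 1) j ↔
    x ∈ R.stage (n + 1) k ∧ p x ∈ R.slice n j
  mem_of_forall_notMem : ∀ w ∈ R.stage (n + 1) 0, (∀ j ≤ n, n - j < k → w ∉ R.slice n j) →
    w ∈ R.stage (n + 1) k
  eq_iff_of_forall_notMem : ∀ w ∈ R.stage (n + 1) 0, (∀ j ≤ n, n - j < k → w ∉ R.slice n j) →
    ∀ x ∈ R.stage (n + 1) k, (p x = w ↔ x = w)

variable {R}

lemma mem_stage_succ_zero {n : ℕ} {x : V} :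
    x ∈ R.stage (n + 1) 0 ↔ x ∈ R.stage n n ∨ x ∈ R.slice (n + 1) (n + 1) := by
  rw [← Finset.mem_coe, R.stage_succ_zero, Set.mem_union, Finset.mem_coe, Finset.mem_coe]

lemma notMem_slice_of_mem_stage {n : ℕ} {x : V} (hx : x ∈ R.slice (n + 1) (n + 1)) :
    x ∉ R.stage n n := by
  rcases R.isNewSlice n with ⟨-, d, -, h, hB⟩ | ⟨-, b, hb, hB⟩
  · rw [← Finset.mem_coe, hB] at hx
    obtain ⟨a, ha, rfl⟩ := hx
    exact (h a ha).1
  · rw [hB, Finset.mem_singleton] at hx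
    rwa [hx]

/-- Offshoot sets of distinct vertices are disjoint, so the last branching is undone by a map `ρ`,
and `p ∘ ρ` is the new parent map. The condition `n - j < k` says that slice `j` has branched by
substage `k`. -/
lemma IsParentMap.exists_succ {n k : ℕ} {p : V → V} (hn : R.SlicesPartition n)
    (hp : R.IsParentMap n k p) (hk : k ≤ n) : ∃ q, R.IsParentMap n (k + 1) q := by
  classical
  obtain ⟨S, hS, hcard, hsing, hstage, hslice⟩ := R.branch n k hk
  have hstage' : ∀ x, x ∈ R.stage (n + 1) (k + 1) ↔ ∃ s ∈ R.stage (n + 1) k, x ∈ S s := fun x => by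
    rw [← Finset.mem_coe, hstage]
    simp
  have hslice' : ∀ x, x ∈ R.slice (n + 1) (n - k) ↔ ∃ s ∈ R.slice n (n - k), x ∈ S s := fun x => by
    rw [← Finset.mem_coe, hslice]
    simp
  have hex : ∀ x, ∃ s, x ∈ R.stage (n + 1) (k + 1) → s ∈ R.stage (n + 1) k ∧ x ∈ S s := fun x => by
    by_cases hx : x ∈ R.stage (n + 1) (k + 1)
    · obtain ⟨s, hs⟩ := (hstage' x).1 hx
      exact ⟨s, fun _ => hs⟩
    · exact ⟨x, fun h => absurd h hx⟩
  choose ρ hρ using hex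
  have hρeq : ∀ s ∈ R.stage (n + 1) k, ∀ x ∈ R.stage (n + 1) (k + 1), ρ x = s ↔ x ∈ S s := by
    intro s hs x hx
    constructor
    · rintro rfl
      exact (hρ x hx).2
    · intro hxs
      by_contra hne
      exact (hS.ne_and_adj_iff (hρ x hx).1 hs (hρ x hx).2 hxs hne).1 rfl
  have hold : ∀ w ∈ R.slice n (n - k), w ∈ R.stage (n + 1) 0 ∧
      ∀ j ≤ n, n - j < k → w ∉ R.slice n j := by
    intro w hw
    refine ⟨mem_stage_succ_zero.2 (Or.inl ((hn.1 w).2 ⟨n - k, by omega, hw⟩)), ?_⟩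
    intro j hj hjk hwj
    have := hn.2 _ (by omega) _ hj w hw hwj
    omega
  -- The slice about to branch is still untouched, so its vertices are their own parents.
  have hfix : ∀ w ∈ R.slice n (n - k), w ∈ R.stage (n + 1) k ∧ p w = w := fun w hw => by
    have h1 := hp.mem_of_forall_notMem w (hold w hw).1 (hold w hw).2
    exact ⟨h1, (hp.eq_iff_of_forall_notMem w (hold w hw).1 (hold w hw).2 w h1).2 rfl⟩
  -- An earlier offshoot does not branch again: its parent lies in another slice, whereas vertices
  -- of slice `n - k` are their own parents.
  have hearly : ∀ j ≤ n, n - j < k → ∀ s ∈ R.stage (n + 1) k, p s ∈ R.slice n j → S s = {s} := by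
    intro j hj hjk s hs hps
    refine hsing s hs fun hsl => ?_
    rw [(hfix s hsl).2] at hps
    have := hn.2 _ (by omega) _ hj s hsl hps
    omega
  have hsame : ∀ j ≤ n, n - j < k → ∀ x, (x ∈ R.stage (n + 1) (k + 1) ∧ p (ρ x) ∈ R.slice n j ↔
      x ∈ R.stage (n + 1) k ∧ p x ∈ R.slice n j) ∧
      (x ∈ R.stage (n + 1) k → p x ∈ R.slice n j → ρ x = x) := by
    intro j hj hjk x
    have h2 : x ∈ R.stage (n + 1) k → p x ∈ R.slice n j →
        x ∈ R.stage (n + 1) (k + 1) ∧ ρ x = x := fun h h' => by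
      have hSx := hearly j hj hjk x h h'
      have hx : x ∈ R.stage (n + 1) (k + 1) := (hstage' x).2 ⟨x, h, by simp [hSx]⟩
      exact ⟨hx, (hρeq x h x hx).2 (by simp [hSx])⟩
    refine ⟨⟨fun ⟨h, h'⟩ => ?_, fun ⟨h, h'⟩ => ?_⟩, fun h h' => (h2 h h').2⟩
    · have hSx := hearly j hj hjk _ (hρ x h).1 h'
      have hx := (hρ x h).2
      rw [hSx, Finset.mem_singleton] at hx
      rw [← hx] at h'
      exact ⟨hx ▸ (hρ x h).1, h'⟩
    · obtain ⟨h3, h4⟩ := h2 h h'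
      exact ⟨h3, by rwa [h4]⟩
  refine ⟨p ∘ ρ, fun x hx => hp.mem _ (hρ x hx).1, fun x hx y hy hxy => ?_, ?_, ?_, ?_, ?_⟩
  · rw [(hS.ne_and_adj_iff (hρ x hx).1 (hρ y hy).1 (hρ x hx).2 (hρ y hy).2
      (fun h => hxy (congrArg p h))).2]
    exact hp.adj_iff _ (hρ x hx).1 _ (hρ y hy).1 hxy
  · intro j hj hjk w hw
    rcases Nat.lt_succ_iff_lt_or_eq.1 hjk with hjk | hjk
    · rw [← hp.card_fiber j hj hjk w hw]
      congr 1
      ext x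
      have := hsame j hj hjk x
      constructor
      · rintro ⟨h, rfl⟩
        obtain ⟨h1, h2⟩ := this.1.1 ⟨h, hw⟩
        exact ⟨h1, by rw [Function.comp_apply, this.2 h1 h2]⟩
      · rintro ⟨h, rfl⟩
        exact ⟨(this.1.2 ⟨h, hw⟩).1, by rw [Function.comp_apply, this.2 h hw]⟩
    · obtain rfl : j = n - k := by omega
      rw [← hcard w hw, ← Set.ncard_coe_finset]
      congr 1
      ext x
      have h1 := hp.eq_iff_of_forall_notMem w (hold w hw).1 (hold w hw).2
      constructor
      · rintro ⟨h, hx⟩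
        exact (hρeq w (hfix w hw).1 x h).1 ((h1 _ (hρ x h).1).1 hx)
      · intro hx
        have h := (hstage' x).2 ⟨w, (hfix w hw).1, hx⟩
        exact ⟨h, (h1 _ (hρ x h).1).2 ((hρeq w (hfix w hw).1 x h).2 hx)⟩
  · intro j hj hjk x
    rcases Nat.lt_succ_iff_lt_or_eq.1 hjk with hjk | hjk
    · rw [hp.mem_slice_iff j hj hjk x]
      exact (hsame j hj hjk x).1.symm
    · obtain rfl : j = n - k := by omega
      rw [hslice']
      constructor
      · rintro ⟨s, hs, hx⟩
        have h := (hstage' x).2 ⟨s, (hfix s hs).1, hx⟩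
        refine ⟨h, ?_⟩
        rwa [Function.comp_apply, (hρeq s (hfix s hs).1 x h).2 hx, (hfix s hs).2]
      · rintro ⟨h, hx⟩
        refine ⟨_, hx, ?_⟩
        have h1 := (hp.eq_iff_of_forall_notMem _ (hold _ hx).1 (hold _ hx).2 _ (hρ x h).1).1 rfl
        rw [← show ρ x = (p ∘ ρ) x from h1]
        exact (hρ x h).2
  · intro w hw hnot
    have hwk := hp.mem_of_forall_notMem w hw fun j hj hjk => hnot j hj (by omega)
    exact (hstage' w).2 ⟨w, hwk, by
      simp [hsing w hwk (hnot (n - k) (by omega) (by omega))]⟩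
  · intro w hw hnot x hx
    have hnot' : ∀ j ≤ n, n - j < k → w ∉ R.slice n j := fun j hj hjk => hnot j hj (by omega)
    have hwk := hp.mem_of_forall_notMem w hw hnot'
    rw [Function.comp_apply, hp.eq_iff_of_forall_notMem w hw hnot' _ (hρ x hx).1,
      hρeq w hwk x hx, hsing w hwk (hnot (n - k) (by omega) (by omega)), Finset.mem_singleton]

lemma exists_isParentMap {n : ℕ} (hn : R.SlicesPartition n) {k : ℕ} (hk : k ≤ n + 1) :
    ∃ p, R.IsParentMap n k p := by
  induction k with
  | zero =>
    exact ⟨id, fun x hx => hx, fun x _ y _ _ => Iff.rfl, fun _ _ h => absurd h (by omega),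
      fun _ _ h => absurd h (by omega), fun w hw _ => hw, fun w _ _ x _ => Iff.rfl⟩
  | succ k ih =>
    obtain ⟨p, hp⟩ := ih (by omega)
    exact hp.exists_succ hn (by omega)

lemma IsParentMap.eq_iff {n : ℕ} {p : V → V} (hn : R.SlicesPartition n)
    (hp : R.IsParentMap n (n + 1) p) {b : V} (hb : b ∈ R.slice (n + 1) (n + 1)) :
    b ∈ R.stage (n + 1) (n + 1) ∧ ∀ x ∈ R.stage (n + 1) (n + 1), (p x = b ↔ x = b) := by
  have h1 : b ∈ R.stage (n + 1) 0 := mem_stage_succ_zero.2 (Or.inr hb)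
  have h2 : ∀ j ≤ n, n - j < n + 1 → b ∉ R.slice n j := fun j hj _ hbj =>
    notMem_slice_of_mem_stage hb ((hn.1 b).2 ⟨j, hj, hbj⟩)
  exact ⟨hp.mem_of_forall_notMem b h1 h2, hp.eq_iff_of_forall_notMem b h1 h2⟩

/-- Each slice of stage `n + 1` is the preimage, under the parent map, of an old slice or of the new
one, so disjointness and covering pull back. -/
lemma slicesPartition (R : Run G φ) (n : ℕ) : R.SlicesPartition n := by
  induction n with
  | zero =>
    refine ⟨fun x => ⟨fun hx => ⟨0, le_rfl, R.slice_zero ▸ hx⟩, ?_⟩, ?_⟩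
    · rintro ⟨i, hi, hx⟩
      obtain rfl : i = 0 := by omega
      exact R.slice_zero ▸ hx
    · intro i hi j hj _ _ _
      omega
  | succ n hn =>
    obtain ⟨p, hp⟩ := exists_isParentMap hn le_rfl
    have hslice : ∀ j ≤ n, ∀ x, x ∈ R.slice (n + 1) j ↔
        x ∈ R.stage (n + 1) (n + 1) ∧ p x ∈ R.slice n j := fun j hj x =>
      hp.mem_slice_iff j hj (by omega) x
    have hnew : ∀ x, x ∈ R.slice (n + 1) (n + 1) ↔
        x ∈ R.stage (n + 1) (n + 1) ∧ p x ∈ R.slice (n + 1) (n + 1) := fun x => by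
      constructor
      · intro hx
        obtain ⟨h1, h2⟩ := hp.eq_iff hn hx
        exact ⟨h1, by rwa [(h2 x h1).2 rfl]⟩
      · rintro ⟨h, hx⟩
        have := ((hp.eq_iff hn hx).2 x h).1 rfl
        rwa [this]
    constructor
    · intro x
      constructor
      · intro hx
        rcases mem_stage_succ_zero.1 (hp.mem x hx) with h | h
        · obtain ⟨j, hj, hxj⟩ := (hn.1 _).1 h
          exact ⟨j, by omega, (hslice j hj x).2 ⟨hx, hxj⟩⟩
        · exact ⟨n + 1, le_rfl, (hnew x).2 ⟨hx, h⟩⟩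
      · rintro ⟨j, hj, hx⟩
        rcases Nat.le_succ_iff.1 hj with hj | rfl
        · exact ((hslice j hj x).1 hx).1
        · exact ((hnew x).1 hx).1
    · intro i hi j hj x hxi hxj
      rcases Nat.le_succ_iff.1 hi with hi | rfl <;> rcases Nat.le_succ_iff.1 hj with hj | rfl
      · exact hn.2 i hi j hj _ ((hslice i hi x).1 hxi).2 ((hslice j hj x).1 hxj).2
      · exact absurd ((hn.1 _).2 ⟨i, hi, ((hslice i hi x).1 hxi).2⟩)
          (notMem_slice_of_mem_stage ((hnew x).1 hxj).2)
      · exact absurd ((hn.1 _).2 ⟨j, hj, ((hslice j hj x).1 hxj).2⟩)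
          (notMem_slice_of_mem_stage ((hnew x).1 hxi).2)
      · rfl

/-- Each vertex of stage `n + 1` is a new witness or one of `2 ^ n * |B|` offshoots of a vertex of
stage `n`, where `B` is the set of new witnesses. -/
lemma exists_parent (R : Run G φ) (n : ℕ) : ∃ p : V → V,
    (∀ x ∈ R.stage (n + 1) (n + 1), p x ∈ R.stage n n ∨ p x ∈ R.slice (n + 1) (n + 1)) ∧
    (∀ x ∈ R.stage (n + 1) (n + 1), ∀ y ∈ R.stage (n + 1) (n + 1), p x ≠ p y →
      (G.Adj x y ↔ G.Adj (p x) (p y))) ∧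
    (∀ w ∈ R.stage n n, {x | x ∈ R.stage (n + 1) (n + 1) ∧ p x = w}.ncard =
      2 ^ n * (R.slice (n + 1) (n + 1)).card) ∧
    ∀ b ∈ R.slice (n + 1) (n + 1), b ∈ R.stage (n + 1) (n + 1) ∧
      ∀ x ∈ R.stage (n + 1) (n + 1), (p x = b ↔ x = b) := by
  obtain ⟨p, hp⟩ := exists_isParentMap (R.slicesPartition n) le_rfl
  refine ⟨p, fun x hx => mem_stage_succ_zero.1 (hp.mem x hx), hp.adj_iff, fun w hw => ?_,
    fun b hb => hp.eq_iff (R.slicesPartition n) hb⟩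
  obtain ⟨j, hj, hwj⟩ := ((R.slicesPartition n).1 w).1 hw
  exact hp.card_fiber j hj (by omega) w hwj

end Run

end Parent

end ToyConstr

namespace ToyConstr

open ProbabilityTheory
open scoped ENNReal

/-! ### Coupling uniform vertices of consecutive stages -/

/-- The map `par n` sends each element of `W (n + 1)` to its parent in `W n`, if it has one: there
is `b > 0` such that `b` elements of `W (n + 1)` have no parent and each element of `W n` is the
parent of `2 ^ n * b` elements. -/
structure IsTower {W : ℕ → Type*} (par : ∀ n, W (n + 1) → Option (W n)) (b : ℕ → ℕ) : Prop where
  pos : ∀ n, 0 < b n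
  card_none : ∀ n, Nat.card {x // par n x = none} = b n
  card_some : ∀ n w, Nat.card {x // par n x = some w} = 2 ^ n * b n

section Resample

variable {W : ℕ → Type*} [∀ n, Fintype (W n)] {par : ∀ n, W (n + 1) → Option (W n)} {b : ℕ → ℕ}

/-- One can combine a uniform element of `W n` and an independent uniform element of `W (n + 1)` to a
uniform element of `W (n + 1)`, so that the result extends the former element unless the latter has
no parent. -/
lemma IsTower.exists_next (h : IsTower par b) (n : ℕ) : ∃ next : W n → W (n + 1) → W (n + 1),
    (∀ w c, par n c = none → next w c = c) ∧
    (∀ w c, par n c ≠ none → par n (next w c) = some w) ∧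
    ∀ x, {p : W n × W (n + 1) | next p.1 p.2 = x}.ncard = Nat.card (W n) := by
  classical
  have he : ∀ w, Nonempty ({x // par n x = some w} ≃ Fin (2 ^ n * b n)) := fun w =>
    ⟨Finite.equivFinOfCardEq (h.card_some n w)⟩
  -- A ranking of the children of every `w`. It lets a child of one vertex be traded for the child
  -- of the same rank of another.
  let e : ∀ w, {x // par n x = some w} ≃ Fin (2 ^ n * b n) := fun w => (he w).some
  let next : W n → W (n + 1) → W (n + 1) := fun w c =>
    if hc : ∃ v, par n c = some v then ((e w).symm (e hc.choose ⟨c, hc.choose_spec⟩) : W (n + 1))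
    else c
  have h1 : ∀ w c, par n c = none → next w c = c := fun w c hc => dif_neg (by simp [hc])
  have h2 : ∀ w v c (hc : par n c = some v), next w c = (e w).symm (e v ⟨c, hc⟩) := by
    intro w v c hc
    have hex : ∃ v, par n c = some v := ⟨v, hc⟩
    have : hex.choose = v := Option.some_injective _ (hex.choose_spec.symm.trans hc)
    refine (dif_pos hex).trans ?_
    subst this
    rfl
  have h3 : ∀ w c, par n c ≠ none → par n (next w c) = some w := by
    intro w c hc
    obtain ⟨v, hv⟩ := Option.ne_none_iff_exists'.1 hc
    rw [h2 w v c hv]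
    exact ((e w).symm _).2
  refine ⟨next, h1, h3, fun x => ?_⟩
  -- An orphan `x` arises from the pairs `(v, x)` with `v` arbitrary. A child `x` of `w₀` arises
  -- from the pairs `(w₀, c)` with `c` the child of the same rank of an arbitrary `v`. Both fibers
  -- have the size of `W n`, which makes the result uniform.
  rcases hx : par n x with _ | w₀
  · have : {p : W n × W (n + 1) | next p.1 p.2 = x} = Set.range fun v : W n => (v, x) := by
      ext ⟨w, c⟩
      simp only [Set.mem_ofPred_eq, Set.mem_range, Prod.mk.injEq, exists_eq_left]
      constructor
      · intro hwc
        by_contra hne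
        by_cases hc : par n c = none
        · exact hne ((h1 w c hc).symm.trans hwc).symm
        · have := h3 w c hc
          rw [hwc, hx] at this
          cases this
      · rintro rfl
        exact h1 w x hx
    rw [this, ← Set.image_univ, Set.ncard_image_of_injective _ (fun v v' h => (Prod.ext_iff.1 h).1),
      Set.ncard_univ]
  · have : {p : W n × W (n + 1) | next p.1 p.2 = x} =
        Set.range fun v : W n => (w₀, ((e v).symm (e w₀ ⟨x, hx⟩) : W (n + 1))) := by
      ext ⟨w, c⟩
      simp only [Set.mem_ofPred_eq, Set.mem_range, Prod.mk.injEq]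
      constructor
      · intro hwc
        by_cases hc : par n c = none
        · rw [h1 w c hc] at hwc
          rw [hwc, hx] at hc
          cases hc
        · obtain ⟨v, hv⟩ := Option.ne_none_iff_exists'.1 hc
          have hw := h3 w c hc
          rw [hwc, hx] at hw
          obtain rfl := Option.some_injective _ hw
          refine ⟨v, rfl, ?_⟩
          have h4 : (⟨x, hx⟩ : {x // par n x = some w₀}) = (e w₀).symm (e v ⟨c, hv⟩) :=
            Subtype.ext (hwc.symm.trans (h2 w₀ v c hv))
          rw [h4]
          simp
      · rintro ⟨v, rfl, rfl⟩
        rw [h2 w₀ v _ ((e v).symm _).2]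
        simp
    rw [this, ← Set.image_univ, Set.ncard_image_of_injective, Set.ncard_univ]
    intro v v' hvv'
    have h4 : ((e v).symm (e w₀ ⟨x, hx⟩) : W (n + 1)) = (e v').symm (e w₀ ⟨x, hx⟩) :=
      (Prod.ext_iff.1 hvv').2
    have h5 := ((e v).symm (e w₀ ⟨x, hx⟩)).2
    have h6 := ((e v').symm (e w₀ ⟨x, hx⟩)).2
    rw [h4, h6] at h5
    exact (Option.some_injective _ h5).symm

lemma IsTower.card_succ (h : IsTower par b) (n : ℕ) :
    Fintype.card (W (n + 1)) = Fintype.card (W n) * (2 ^ n * b n) + b n := by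
  classical
  have e : W (n + 1) ≃ Σ o : Option (W n), {x // par n x = o} :=
    (Equiv.sigmaFiberEquiv (par n)).symm
  rw [← Nat.card_eq_fintype_card, Nat.card_congr e, Nat.card_sigma, Fintype.sum_option, h.card_none]
  simp only [h.card_some, Finset.sum_const, Finset.card_univ, smul_eq_mul]
  exact Nat.add_comm _ _

lemma IsTower.two_pow_mul_le_card [∀ n, Nonempty (W n)] (h : IsTower par b) (n : ℕ) :
    2 ^ n * b n ≤ Fintype.card (W (n + 1)) := by
  rw [h.card_succ]
  exact (Nat.le_mul_of_pos_left _ Fintype.card_pos).trans (Nat.le_add_right _ _)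

lemma IsTower.two_pow_le_card [∀ n, Nonempty (W n)] (h : IsTower par b) (n : ℕ) :
    2 ^ n ≤ Fintype.card (W (n + 1)) :=
  (Nat.le_mul_of_pos_right _ (h.pos n)).trans (h.two_pow_mul_le_card n)

end Resample

/-! ### The chain of vertices and its uniform marginals -/

section Chain

variable {W : ℕ → Type*}

/-- The chain obtained from a sequence of candidates by means of the maps `next`. -/
def chain (next : ∀ n, W n → W (n + 1) → W (n + 1)) : ∀ n, (∀ n, W n) → W n
  | 0, ω => ω 0
  | n + 1, ω => next n (chain next n ω) (ω (n + 1))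

lemma chain_congr (next : ∀ n, W n → W (n + 1) → W (n + 1)) {n : ℕ} {ω ω' : ∀ n, W n}
    (h : ∀ i ≤ n, ω i = ω' i) : chain next n ω = chain next n ω' := by
  induction n with
  | zero => exact h 0 le_rfl
  | succ n ih => rw [chain, chain, ih fun i hi => h i (by omega), h (n + 1) le_rfl]

variable [∀ n, Fintype (W n)] [∀ n, MeasurableSpace (W n)] [∀ n, DiscreteMeasurableSpace (W n)]

lemma measurable_chain (next : ∀ n, W n → W (n + 1) → W (n + 1)) (n : ℕ) :
    Measurable (chain next n) := by
  induction n with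
  | zero => exact measurable_pi_apply 0
  | succ n ih =>
    have : Measurable fun p : W n × W (n + 1) => next n p.1 p.2 := measurable_of_finite _
    exact this.comp (ih.prodMk (measurable_pi_apply (n + 1)))

variable [∀ n, Nonempty (W n)]

/-- The law of independent uniform elements of the sets `W n`. -/
def candidateLaw (W : ℕ → Type*) [∀ n, Fintype (W n)] [∀ n, Nonempty (W n)]
    [∀ n, MeasurableSpace (W n)] : Measure (∀ n, W n) :=
  Measure.infinitePi fun n => (PMF.uniformOfFintype (W n)).toMeasure

instance : IsProbabilityMeasure (candidateLaw W) := by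
  unfold candidateLaw
  infer_instance

/-- The chain up to time `n` depends only on candidates with index at most `n`; `ext` fills the
remaining coordinates arbitrarily. -/
lemma indepFun_chain (next : ∀ n, W n → W (n + 1) → W (n + 1)) {n m : ℕ} (hnm : n < m) :
    IndepFun (chain next n) (fun ω => ω m) (candidateLaw W) := by
  have hind : iIndepFun (fun i (ω : ∀ n, W n) => ω i) (candidateLaw W) :=
    iIndepFun_infinitePi (X := fun _ x => x) (fun i => measurable_id)
  have hd : Disjoint (Finset.range (n + 1)) {m} := by simp; omega
  have h := hind.indepFun_finset _ _ hd fun i => measurable_pi_apply i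
  let ext : (∀ i : Finset.range (n + 1), W i) → ∀ n, W n := fun r i =>
    if hi : i ∈ Finset.range (n + 1) then r ⟨i, hi⟩ else Classical.arbitrary _
  have hext : Measurable ext := by
    refine measurable_pi_iff.2 fun i => ?_
    by_cases hi : i ∈ Finset.range (n + 1)
    · simp only [ext, hi, dif_pos]
      exact measurable_pi_apply _
    · simp only [ext, hi, dif_neg, not_false_eq_true]
      exact measurable_const
  have h' := h.comp ((measurable_chain next n).comp hext)
    (measurable_pi_apply (⟨m, Finset.mem_singleton_self m⟩ : ({m} : Finset ℕ)))
  refine h'.congr (Eventually.of_forall fun ω => ?_) (Eventually.of_forall fun ω => rfl)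
  refine chain_congr next fun i hi => ?_
  simp only [ext, Finset.mem_range, Nat.lt_succ_of_le hi, dif_pos]

lemma uniform_apply_singleton {A : Type*} [Fintype A] [Nonempty A] [MeasurableSpace A]
    [DiscreteMeasurableSpace A] (x : A) :
    (PMF.uniformOfFintype A).toMeasure {x} = (Fintype.card A : ℝ≥0∞)⁻¹ := by
  rw [PMF.toMeasure_apply_singleton _ _ (MeasurableSet.of_discrete), PMF.uniformOfFintype_apply]

lemma candidateLaw_eval (n : ℕ) (s : Set (W n)) :
    candidateLaw W {ω | ω n ∈ s} = (PMF.uniformOfFintype (W n)).toMeasure s :=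
  (measurePreserving_eval_infinitePi (fun n => (PMF.uniformOfFintype (W n)).toMeasure)
    n).measure_preimage MeasurableSet.of_discrete.nullMeasurableSet

variable {next : ∀ n, W n → W (n + 1) → W (n + 1)}

lemma candidateLaw_chain_inter {n m : ℕ} (hnm : n < m) (x : W n) (s : Set (W m)) :
    candidateLaw W {ω | chain next n ω = x ∧ ω m ∈ s} =
      candidateLaw W {ω | chain next n ω = x} * (PMF.uniformOfFintype (W m)).toMeasure s := by
  have := (indepFun_chain next hnm).measure_inter_preimage_eq_mul {x} s MeasurableSet.of_discrete
    MeasurableSet.of_discrete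
  rw [← candidateLaw_eval]
  exact this

lemma candidateLaw_chain (hnext : ∀ n x, {p : W n × W (n + 1) | next n p.1 p.2 = x}.ncard =
    Nat.card (W n)) (n : ℕ) (x : W n) :
    candidateLaw W {ω | chain next n ω = x} = (Fintype.card (W n) : ℝ≥0∞)⁻¹ := by
  classical
  induction n with
  | zero => exact (candidateLaw_eval 0 {x}).trans (uniform_apply_singleton x)
  | succ n ih =>
    let T := {p : W n × W (n + 1) | next n p.1 p.2 = x}.toFinset
    have hT : T.card = Fintype.card (W n) := by
      rw [← Nat.card_eq_fintype_card, ← hnext n x, Set.ncard_eq_toFinset_card']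
    have hset : {ω | chain next (n + 1) ω = x} =
        ⋃ p ∈ T, {ω | chain next n ω = p.1 ∧ ω (n + 1) ∈ ({p.2} : Set (W (n + 1)))} := by
      ext ω
      simp only [Set.mem_ofPred_eq, Set.mem_iUnion, chain, T, Set.mem_toFinset,
        Set.mem_singleton_iff, exists_prop, Prod.exists]
      constructor
      · intro h
        exact ⟨_, _, h, rfl, rfl⟩
      · rintro ⟨u, v, h, rfl, rfl⟩
        exact h
    rw [hset, measure_biUnion_finset]
    · simp only [candidateLaw_chain_inter (Nat.lt_succ_self n), ih, uniform_apply_singleton,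
        Finset.sum_const, hT, nsmul_eq_mul]
      rw [← mul_assoc, ENNReal.mul_inv_cancel, one_mul]
      · exact_mod_cast Fintype.card_ne_zero
      · exact ENNReal.natCast_ne_top _
    · rintro p - q - hpq
      refine Set.disjoint_left.2 fun ω hω hω' => hpq (Prod.ext ?_ ?_)
      · exact hω.1.symm.trans hω'.1
      · exact (Set.mem_singleton_iff.1 hω.2).symm.trans hω'.2
    · intro p _
      exact ((measurable_chain next n) (MeasurableSet.of_discrete (s := {p.1}))).inter
        ((measurable_pi_apply (n + 1)) (MeasurableSet.of_discrete (s := {p.2})))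

lemma map_chain (hnext : ∀ n x, {p : W n × W (n + 1) | next n p.1 p.2 = x}.ncard =
    Nat.card (W n)) (n : ℕ) :
    (candidateLaw W).map (chain next n) = (PMF.uniformOfFintype (W n)).toMeasure := by
  refine Measure.ext_of_singleton fun x => ?_
  rw [Measure.map_apply (measurable_chain next n) MeasurableSet.of_discrete,
    uniform_apply_singleton, ← candidateLaw_chain hnext n x]
  rfl

end Chain

/-! ### Almost sure behaviour of independent chains -/

section Stabilize

variable {W : ℕ → Type*} {par : ∀ n, W (n + 1) → Option (W n)} {b : ℕ → ℕ}
  {next : ∀ n, W n → W (n + 1) → W (n + 1)}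

/-- The sequence `y` is a trajectory each of whose terms after time `n` has the previous term as its
parent. -/
def StableFrom (par : ∀ n, W (n + 1) → Option (W n)) (y : ∀ n, W n) (n : ℕ) : Prop :=
  ∀ m ≥ n, par m (y (m + 1)) = some (y m)

/-- The sequences `Y k` are eventually stable, eventually distinct, and each vertex of a late stage
occurs in one of them after that has stabilized. -/
structure IsGenericFamily (par : ∀ n, W (n + 1) → Option (W n)) (Y : ℕ → ∀ n, W n) : Prop where
  eventually_stable : ∀ k, ∃ n, StableFrom par (Y k) n
  eventually_ne : ∀ j k, j ≠ k → ∀ᶠ n in atTop, Y j n ≠ Y k n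
  exists_eq : ∀ n ≥ 2, ∀ d : W n, ∃ k, Y k n = d ∧ StableFrom par (Y k) n

lemma stableFrom_chain (hnext : ∀ n w c, par n c ≠ none → par n (next n w c) = some w)
    {ω : ∀ n, W n} {n : ℕ} (h : ∀ m ≥ n, par m (ω (m + 1)) ≠ none) :
    StableFrom par (fun n => chain next n ω) n :=
  fun m hm => hnext m _ _ (h m hm)

/-- The law of a sequence of independent sequences of candidates. -/
def familyLaw (W : ℕ → Type*) [∀ n, Fintype (W n)] [∀ n, Nonempty (W n)]
    [∀ n, MeasurableSpace (W n)] : Measure (ℕ → ∀ n, W n) :=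
  Measure.infinitePi fun _ => candidateLaw W

variable [∀ n, MeasurableSpace (W n)]

section FamilyLaw

variable [∀ n, Fintype (W n)] [∀ n, Nonempty (W n)]

instance : IsProbabilityMeasure (familyLaw W) := by
  unfold familyLaw
  infer_instance

lemma ae_familyLaw {p : (∀ n, W n) → Prop} (h : ∀ᵐ ω ∂candidateLaw W, p ω) (k : ℕ) :
    ∀ᵐ ω ∂familyLaw W, p (ω k) :=
  (measurePreserving_eval_infinitePi (fun _ : ℕ => candidateLaw W) k).quasiMeasurePreserving.ae h

/-- The first `N` independent trials all fail with probability at most `(1 - P(E)) ^ N`, which tends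
to `0`. -/
lemma ae_familyLaw_exists_mem {E : Set (∀ n, W n)} (hE : MeasurableSet E)
    (h : candidateLaw W E ≠ 0) : ∀ᵐ ω ∂familyLaw W, ∃ k : ℕ, ω k ∈ E := by
  have hlt : candidateLaw W Eᶜ < 1 := by
    rw [prob_compl_eq_one_sub hE]
    exact ENNReal.sub_lt_self (by simp) (by simp) h
  have hle : ∀ N : ℕ, familyLaw W {ω | ¬ ∃ k : ℕ, ω k ∈ E} ≤ (candidateLaw W Eᶜ) ^ N := by
    intro N
    have := Measure.infinitePi_pi (fun _ : ℕ => candidateLaw W) (s := Finset.range N)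
      (t := fun _ => Eᶜ) (fun _ _ => hE.compl)
    rw [Finset.prod_const, Finset.card_range] at this
    rw [← this]
    refine measure_mono fun ω hω k _ hk => hω ⟨k, hk⟩
  exact le_antisymm (ge_of_tendsto'
    (ENNReal.tendsto_pow_atTop_nhds_zero_of_lt_one hlt) hle) zero_le

end FamilyLaw

variable [∀ n, DiscreteMeasurableSpace (W n)]

lemma measurableSet_none (n : ℕ) : MeasurableSet {ω : ∀ n, W n | par n (ω (n + 1)) = none} :=
  measurable_pi_apply (n + 1) (MeasurableSet.of_discrete (s := {c | par n c = none}))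

variable [∀ n, Fintype (W n)]

lemma measurableSet_chain_eq (next : ∀ n, W n → W (n + 1) → W (n + 1)) (n : ℕ) (d : W n) :
    MeasurableSet {ω | chain next n ω = d} :=
  measurable_chain next n (MeasurableSet.of_discrete (s := {d}))

lemma measurableSet_chain_eq_stable (n : ℕ) (d : W n) :
    MeasurableSet {ω | chain next n ω = d ∧ ∀ m ≥ n, par m (ω (m + 1)) ≠ none} := by
  refine (measurableSet_chain_eq next n d).inter ?_
  have : {ω : ∀ n, W n | ∀ m ≥ n, par m (ω (m + 1)) ≠ none} =
      ⋂ m, ⋂ _ : m ≥ n, {ω : ∀ n, W n | par m (ω (m + 1)) = none}ᶜ := by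
    ext ω
    simp
  change MeasurableSet {ω : ∀ n, W n | ∀ m ≥ n, par m (ω (m + 1)) ≠ none}
  rw [this]
  exact MeasurableSet.iInter fun m => MeasurableSet.iInter fun _ => (measurableSet_none m).compl

variable [∀ n, Nonempty (W n)]

lemma IsTower.uniform_none_le (h : IsTower par b) (n : ℕ) :
    (PMF.uniformOfFintype (W (n + 1))).toMeasure {c | par n c = none} ≤ (2⁻¹ : ℝ≥0∞) ^ n := by
  classical
  rw [PMF.toMeasure_uniformOfFintype_apply _ MeasurableSet.of_discrete]
  have h1 : Fintype.card {c | par n c = none} = b n := by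
    rw [← h.card_none n, Nat.card_eq_fintype_card]
    rfl
  rw [h1]
  refine ENNReal.div_le_of_le_mul ?_
  rw [← ENNReal.inv_pow, mul_comm, ← div_eq_mul_inv]
  refine (ENNReal.le_div_iff_mul_le (Or.inl (by simp)) (Or.inl (by simp))).2 ?_
  have := h.two_pow_mul_le_card n
  rw [mul_comm]
  exact_mod_cast this

lemma IsTower.ae_eventually_ne_none (h : IsTower par b) :
    ∀ᵐ ω ∂candidateLaw W, ∀ᶠ n in atTop, par n (ω (n + 1)) ≠ none := by
  refine ae_eventually_notMem (μ := candidateLaw W) (s := fun n => {ω | par n (ω (n + 1)) = none}) ?_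
  refine ne_top_of_le_ne_top (b := ∑' n, (2⁻¹ : ℝ≥0∞) ^ n) ?_ (ENNReal.tsum_le_tsum fun n => ?_)
  · rw [ENNReal.tsum_geometric, ENNReal.one_sub_inv_two, inv_inv]
    exact ENNReal.ofNat_ne_top
  · exact (candidateLaw_eval (n + 1) {c | par n c = none}).le.trans (h.uniform_none_le n)

/-- Later jumps are independent of the position at time `n`, and their probabilities sum to at most
`2 * 2⁻ⁿ`. For `n ≥ 2` this is at most one half, so a chain at `d` stays jump-free with positive
conditional probability. -/
lemma IsTower.candidateLaw_stable_ne_zero (h : IsTower par b)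
    (hnext : ∀ n x, {p : W n × W (n + 1) | next n p.1 p.2 = x}.ncard = Nat.card (W n))
    {n : ℕ} (hn : 2 ≤ n) (d : W n) :
    candidateLaw W {ω | chain next n ω = d ∧ ∀ m ≥ n, par m (ω (m + 1)) ≠ none} ≠ 0 := by
  intro h0
  set p := candidateLaw W {ω | chain next n ω = d} with hp
  have hp0 : p ≠ 0 := by
    rw [hp, candidateLaw_chain hnext]
    simp
  have hp1 : p ≠ ⊤ := measure_ne_top _ _
  have hsub : {ω | chain next n ω = d} ⊆
      {ω | chain next n ω = d ∧ ∀ m ≥ n, par m (ω (m + 1)) ≠ none} ∪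
        ⋃ k, {ω | chain next n ω = d ∧ ω (n + k + 1) ∈ {c | par (n + k) c = none}} := by
    intro ω hω
    by_cases hs : ∀ m ≥ n, par m (ω (m + 1)) ≠ none
    · exact Or.inl ⟨hω, hs⟩
    · push Not at hs
      obtain ⟨m, hm, hs⟩ := hs
      obtain ⟨k, rfl⟩ := Nat.exists_eq_add_of_le hm
      exact Or.inr (Set.mem_iUnion.2 ⟨k, hω, hs⟩)
  have hle : p ≤ p * 2⁻¹ := by
    calc p ≤ 0 + ∑' k, candidateLaw W
          {ω | chain next n ω = d ∧ ω (n + k + 1) ∈ {c | par (n + k) c = none}} := by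
          refine (measure_mono hsub).trans ((measure_union_le _ _).trans ?_)
          rw [h0]
          gcongr
          exact measure_iUnion_le _
      _ ≤ ∑' k, p * (2⁻¹ : ℝ≥0∞) ^ (n + k) := by
          rw [zero_add]
          refine ENNReal.tsum_le_tsum fun k => ?_
          rw [candidateLaw_chain_inter (by omega)]
          gcongr
          exact h.uniform_none_le (n + k)
      _ = p * ((2⁻¹ : ℝ≥0∞) ^ n * 2) := by
          simp only [pow_add, ENNReal.tsum_mul_left]
          rw [ENNReal.tsum_geometric, ENNReal.one_sub_inv_two, inv_inv]
      _ ≤ p * 2⁻¹ := by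
          gcongr
          calc (2⁻¹ : ℝ≥0∞) ^ n * 2 ≤ (2⁻¹ : ℝ≥0∞) ^ 2 * 2 := by
                gcongr ?_ * 2
                exact pow_le_pow_right_of_le_one' (by simp) hn
            _ = 2⁻¹ := by
                rw [pow_two, mul_assoc, ENNReal.inv_mul_cancel (by simp) (by simp), mul_one]
  rw [← div_eq_mul_inv] at hle
  exact absurd hle (not_le.2 (ENNReal.half_lt_self hp0 hp1))

lemma map_family (hnext : ∀ n x, {p : W n × W (n + 1) | next n p.1 p.2 = x}.ncard =
    Nat.card (W n)) (n : ℕ) :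
    (familyLaw W).map (fun ω k => chain next n (ω k)) =
      Measure.infinitePi fun _ => (PMF.uniformOfFintype (W n)).toMeasure := by
  rw [familyLaw, Measure.infinitePi_map_pi (f := fun _ => chain next n) _
    fun _ => measurable_chain next n, map_chain hnext]

lemma familyLaw_chain_eq (hnext : ∀ n x, {p : W n × W (n + 1) | next n p.1 p.2 = x}.ncard =
    Nat.card (W n)) (n : ℕ) {j k : ℕ} (hjk : j ≠ k) :
    familyLaw W {ω | chain next n (ω j) = chain next n (ω k)} = (Fintype.card (W n) : ℝ≥0∞)⁻¹ := by
  have hm : Measurable fun (ω : ℕ → ∀ n, W n) (k : ℕ) => chain next n (ω k) :=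
    measurable_pi_iff.2 fun k => (measurable_chain next n).comp (measurable_pi_apply k)
  have hD : MeasurableSet {p : W n × W n | p.1 = p.2} := MeasurableSet.of_discrete
  have h1 := Measure.infinitePi_map_eval_prod
    (P := fun _ : ℕ => (PMF.uniformOfFintype (W n)).toMeasure) hjk
  have hm2 : Measurable fun ω : ℕ → W n => (ω j, ω k) :=
    (measurable_pi_apply j).prodMk (measurable_pi_apply k)
  rw [← map_family hnext n, Measure.map_map hm2 hm] at h1
  have h2 := congrArg (fun μ => μ {p : W n × W n | p.1 = p.2}) h1
  simp only [Measure.map_apply (hm2.comp hm) hD, Measure.prod_apply hD] at h2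
  refine Eq.trans h2 ?_
  have : ∀ x : W n, Prod.mk x ⁻¹' {p : W n × W n | p.1 = p.2} = {x} := fun x => by
    ext y
    exact eq_comm
  simp only [this, uniform_apply_singleton, lintegral_const, measure_univ, mul_one]

/-- Stability and distinctness come from Borel–Cantelli, with jump probabilities at most `2⁻ⁿ` and
collision probabilities `1 / |W (n + 1)| ≤ 2⁻ⁿ`. Occupation of each `d` comes from infinitely many
independent trials of positive probability. -/
lemma IsTower.ae_isGenericFamily (h : IsTower par b)
    (hnext₁ : ∀ n w c, par n c ≠ none → par n (next n w c) = some w)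
    (hnext₂ : ∀ n x, {p : W n × W (n + 1) | next n p.1 p.2 = x}.ncard = Nat.card (W n)) :
    ∀ᵐ ω ∂familyLaw W, IsGenericFamily par fun k n => chain next n (ω k) := by
  have h1 : ∀ᵐ ω ∂familyLaw W, ∀ k : ℕ, ∀ᶠ n in atTop, par n (ω k (n + 1)) ≠ none :=
    ae_all_iff.2 fun k => ae_familyLaw h.ae_eventually_ne_none k
  have h2 : ∀ᵐ ω ∂familyLaw W, ∀ j k : ℕ, j ≠ k → ∀ᶠ n in atTop,
      chain next (n + 1) (ω j) ≠ chain next (n + 1) (ω k) := by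
    refine ae_all_iff.2 fun j => ae_all_iff.2 fun k => ?_
    rcases eq_or_ne j k with hjk | hjk
    · exact Eventually.of_forall fun ω hne => absurd hjk hne
    · have := ae_eventually_notMem (μ := familyLaw W)
        (s := fun n => {ω | chain next (n + 1) (ω j) = chain next (n + 1) (ω k)})
        (ne_top_of_le_ne_top (b := ∑' n, (2⁻¹ : ℝ≥0∞) ^ n) (by
          rw [ENNReal.tsum_geometric, ENNReal.one_sub_inv_two, inv_inv]
          exact ENNReal.ofNat_ne_top) (ENNReal.tsum_le_tsum fun n => by
          rw [familyLaw_chain_eq hnext₂ (n + 1) hjk, ← ENNReal.inv_pow, ENNReal.inv_le_inv]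
          exact_mod_cast h.two_pow_le_card n))
      filter_upwards [this] with ω hω _ using hω
  have h3 : ∀ᵐ ω ∂familyLaw W, ∀ n : ℕ, ∀ d : W n, 2 ≤ n → ∃ k : ℕ,
      ω k ∈ {ω | chain next n ω = d ∧ ∀ m ≥ n, par m (ω (m + 1)) ≠ none} := by
    refine ae_all_iff.2 fun n => ae_all_iff.2 fun d => ?_
    by_cases hn : 2 ≤ n
    · filter_upwards [ae_familyLaw_exists_mem (measurableSet_chain_eq_stable n d)
        (h.candidateLaw_stable_ne_zero hnext₂ hn d)] with ω hω _ using hω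
    · exact Eventually.of_forall fun ω h => absurd h hn
  filter_upwards [h1, h2, h3] with ω hω₁ hω₂ hω₃
  refine ⟨fun k => ?_, fun j k hjk => ?_, fun n hn d => ?_⟩
  · obtain ⟨n, hn⟩ := eventually_atTop.1 (hω₁ k)
    exact ⟨n, stableFrom_chain hnext₁ hn⟩
  · obtain ⟨n, hn⟩ := eventually_atTop.1 (hω₂ j k hjk)
    refine eventually_atTop.2 ⟨n + 1, fun m hm => ?_⟩
    obtain ⟨m, rfl⟩ : ∃ l, m = l + 1 := ⟨m - 1, by omega⟩
    exact hn m (by omega)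
  · obtain ⟨k, hk₁, hk₂⟩ := hω₃ n d hn
    exact ⟨k, hk₁, stableFrom_chain hnext₁ hk₂⟩

end Stabilize

/-! ### The limit graph and convergence in distribution -/

section Limit

variable {W : ℕ → Type*} {par : ∀ n, W (n + 1) → Option (W n)} {b : ℕ → ℕ}

/-- The graph on `ℕ` in which `j` and `k` are adjacent iff `Y j n` and `Y k n` are adjacent for all
large `n`. -/
def limitGraph (F : ∀ n, SimpleGraph (W n)) (Y : ℕ → ∀ n, W n) : SimpleGraph ℕ where
  Adj j k := ∀ᶠ n in atTop, (F n).Adj (Y j n) (Y k n)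
  symm := ⟨fun _ _ h => h.mono fun _ h => h.symm⟩
  loopless := ⟨fun _ h => h.exists.elim fun _ h => h.ne rfl⟩

/-- Vertices with different parents have the same adjacency as their parents. -/
def IsTransversal (F : ∀ n, SimpleGraph (W n)) (par : ∀ n, W (n + 1) → Option (W n)) : Prop :=
  ∀ n x y w v, par n x = some w → par n y = some v → w ≠ v →
    ((F (n + 1)).Adj x y ↔ (F n).Adj w v)

variable {F : ∀ n, SimpleGraph (W n)}

lemma StableFrom.mono {y : ∀ n, W n} {n m : ℕ} (h : StableFrom par y n) (hnm : n ≤ m) :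
    StableFrom par y m := fun l hl => h l (hnm.trans hl)

/-- A vertex has only one parent, so stable trajectories that are distinct at time `n` never meet,
and transversality passes their adjacency from each stage to the next. -/
lemma StableFrom.ne_and_adj_iff (hF : IsTransversal F par) {y z : ∀ n, W n} {n : ℕ}
    (hy : StableFrom par y n) (hz : StableFrom par z n) (hne : y n ≠ z n) {m : ℕ} (hm : n ≤ m) :
    y m ≠ z m ∧ ((F m).Adj (y m) (z m) ↔ (F n).Adj (y n) (z n)) := by
  induction m, hm using Nat.le_induction with
  | base => exact ⟨hne, Iff.rfl⟩
  | succ m hm ih =>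
    refine ⟨fun h => ih.1 (Option.some_injective _ ?_), ?_⟩
    · rw [← hy m hm, ← hz m hm, h]
    · rw [hF m _ _ _ _ (hy m hm) (hz m hm) ih.1, ih.2]

lemma samePattern_limitGraph (hF : IsTransversal F par) {Y : ℕ → ∀ n, W n} {ι : Type*} {a : ι → ℕ}
    {n : ℕ} (h₁ : ∀ i, StableFrom par (Y (a i)) n)
    (h₂ : ∀ i j, a i ≠ a j → Y (a i) n ≠ Y (a j) n) :
    SamePattern (limitGraph F Y).Adj (F n).Adj a (fun i => Y (a i) n) := by
  intro i j
  by_cases hij : a i = a j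
  · simp [hij]
  · refine ⟨iff_of_false hij (h₂ i j hij), ?_⟩
    have := fun m hm => ((h₁ i).ne_and_adj_iff hF (h₁ j) (h₂ i j hij) (m := m) hm).2
    constructor
    · intro h
      obtain ⟨m, hm, hm'⟩ := (h.and (eventually_ge_atTop n)).exists
      exact (this m hm').1 hm
    · intro h
      exact eventually_atTop.2 ⟨n, fun m hm => (this m hm).2 h⟩

lemma IsGenericFamily.eventually {Y : ℕ → ∀ n, W n} (hY : IsGenericFamily par Y) {ι : Type*}
    [Finite ι] (a : ι → ℕ) : ∀ᶠ n in atTop, (∀ i, StableFrom par (Y (a i)) n) ∧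
      ∀ i j, a i ≠ a j → Y (a i) n ≠ Y (a j) n := by
  refine (eventually_all.2 fun i => ?_).and (eventually_all.2 fun i => eventually_all.2 fun j => ?_)
  · obtain ⟨n, hn⟩ := hY.eventually_stable (a i)
    exact eventually_atTop.2 ⟨n, fun m hm => hn.mono hm⟩
  · by_cases hij : a i = a j
    · exact Eventually.of_forall fun n h => absurd hij h
    · exact (hY.eventually_ne _ _ hij).mono fun n h _ => h

lemma IsGenericFamily.tendsto (hF : IsTransversal F par) {Y : ℕ → ∀ n, W n}
    (hY : IsGenericFamily par Y) :
    Tendsto (fun n => (F n).comap fun k => Y k n) atTop (𝓝 (limitGraph F Y)) := by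
  classical
  rw [nhds_induced, tendsto_comap_iff, tendsto_pi_nhds]
  rintro ⟨j, k⟩
  refine tendsto_nhds_of_eventually_eq ?_
  have hjk := hY.eventually ![j, k]
  filter_upwards [hjk] with n hn
  have := (samePattern_limitGraph hF hn.1 hn.2 0 1).2
  simp only [Function.comp_apply, SimpleGraph.comap_adj, decide_eq_decide]
  exact this.symm

section Law

variable [∀ n, Fintype (W n)]

lemma measurable_limitGraph [∀ n, MeasurableSpace (W n)] [∀ n, DiscreteMeasurableSpace (W n)]
    (F : ∀ n, SimpleGraph (W n)) (next : ∀ n, W n → W (n + 1) → W (n + 1)) :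
    Measurable fun ω : ℕ → ∀ n, W n => limitGraph F fun k n => chain next n (ω k) := by
  rw [SimpleGraph.measurable_iff_adj]
  intro u v
  have h : ∀ n, Measurable fun ω : ℕ → ∀ n, W n => (F n).Adj (chain next n (ω u))
      (chain next n (ω v)) := fun n =>
    (measurable_of_finite fun p : W n × W n => (F n).Adj p.1 p.2).comp
      (((measurable_chain next n).comp (measurable_pi_apply u)).prodMk
        ((measurable_chain next n).comp (measurable_pi_apply v)))
  simp only [limitGraph, eventually_atTop]
  exact Measurable.exists fun N => Measurable.forall fun n => Measurable.imp measurable_const (h n)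

variable [∀ n, Nonempty (W n)]

lemma map_comp_familyLaw [∀ n, MeasurableSpace (W n)] (g : Equiv.Perm ℕ) :
    (familyLaw W).map (fun ω => ω ∘ g) = familyLaw W := by
  have h := Measure.infinitePi_map_piCongrLeft (fun _ : ℕ => candidateLaw W) g.symm
  have : ⇑(MeasurableEquiv.piCongrLeft (fun _ : ℕ => ∀ n, W n) g.symm) = fun ω => ω ∘ g := by
    funext ω k
    obtain ⟨k, rfl⟩ := g.symm.surjective k
    rw [MeasurableEquiv.coe_piCongrLeft, Equiv.piCongrLeft_apply_apply]
    simp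
  rw [this] at h
  exact h

lemma logicAction_image (g : Equiv.Perm ℕ) (X : Set (SimpleGraph ℕ)) :
    logicAction g '' X = logicAction g⁻¹ ⁻¹' X := by
  refine congrFun (Set.image_eq_preimage_of_inverse (fun H => ?_) fun H => ?_) X
  · ext j k
    simp [logicAction]
  · ext j k
    simp [logicAction]

lemma measurable_logicAction (g : Equiv.Perm ℕ) : Measurable (logicAction g) := by
  rw [SimpleGraph.measurable_iff_adj]
  intro u v
  exact SimpleGraph.measurable_iff_adj.1 measurable_id (g⁻¹ u) (g⁻¹ v)

/-- The graphs sampled from the levels of a tower converge in distribution to a random graph that is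
almost surely the limit graph of a generic family. -/
lemma IsTower.exists_limit (h : IsTower par b) (hF : IsTransversal F par) :
    ∃ μ : ProbabilityMeasure (SimpleGraph ℕ),
      Tendsto (fun n => sampledGraph (F n)) atTop (𝓝 μ) ∧
      IsSymInvariant (μ : Measure (SimpleGraph ℕ)) ∧
      ∀ X : Set (SimpleGraph ℕ), MeasurableSet X →
        (∀ Y, IsGenericFamily par Y → limitGraph F Y ∈ X) → (μ : Measure (SimpleGraph ℕ)) X = 1 := by
  choose next _ hnext₁ hnext₂ using h.exists_next
  let _ : ∀ n, MeasurableSpace (W n) := fun _ => ⊤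
  have : ∀ n, DiscreteMeasurableSpace (W n) := fun n => ⟨fun _ => trivial⟩
  have hgen := h.ae_isGenericFamily hnext₁ hnext₂
  have hlim := measurable_limitGraph F next
  have hfam : ∀ n, Measurable fun (ω : ℕ → ∀ n, W n) (k : ℕ) => chain next n (ω k) := fun n =>
    measurable_pi_iff.2 fun k => (measurable_chain next n).comp (measurable_pi_apply k)
  have hsample : ∀ n, sampledMeasure (F n) =
      (familyLaw W).map fun ω => (F n).comap fun k => chain next n (ω k) := fun n => by
    have h1 : iidUniform (W n) = (familyLaw W).map fun ω k => chain next n (ω k) :=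
      (map_family hnext₂ n).symm
    rw [sampledMeasure, h1, Measure.map_map (measurable_pullbackGraph (F n)) (hfam n)]
    rfl
  -- Almost sure convergence of the coupled samples yields convergence in distribution.
  have hdist : TendstoInDistribution
      (fun n (ω : ℕ → ∀ n, W n) => (F n).comap fun k => chain next n (ω k)) atTop
      (fun ω => limitGraph F fun k n => chain next n (ω k)) (fun _ => familyLaw W)
      (familyLaw W) :=
    tendstoInDistribution_of_ae_tendsto
      (fun n => ((measurable_pullbackGraph (F n)).comp (hfam n)).aemeasurable)
      hlim.aemeasurable (hgen.mono fun ω hω => hω.tendsto hF)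
  refine ⟨⟨(familyLaw W).map fun ω => limitGraph F fun k n => chain next n (ω k),
    Measure.isProbabilityMeasure_map hlim.aemeasurable⟩, ?_, ?_, ?_⟩
  · have hn : (fun n => sampledGraph (F n)) = fun n => ⟨_, Measure.isProbabilityMeasure_map
        (hdist.forall_aemeasurable n)⟩ := funext fun n => Subtype.ext (hsample n)
    rw [hn]
    exact hdist.tendsto
  · intro g X hX
    change (familyLaw W).map _ _ = (familyLaw W).map _ _
    rw [logicAction_image, Measure.map_apply hlim (measurable_logicAction _ hX),
      Measure.map_apply hlim hX]
    -- Relabelling the limit graph amounts to permuting the chains, which preserves their joint law.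
    conv_rhs => rw [← map_comp_familyLaw g]
    have hg : Measurable fun ω : ℕ → ∀ n, W n => ω ∘ g :=
      measurable_pi_iff.2 fun k => measurable_pi_apply (g k)
    rw [Measure.map_apply hg (hlim hX)]
    rfl
  · intro X hX hY
    change (familyLaw W).map _ _ = 1
    rw [Measure.map_apply hlim hX]
    exact (prob_compl_eq_zero_iff (hlim hX)).1 (hgen.mono fun ω hω => hY _ hω)

end Law

end Limit

end ToyConstr

namespace ToyConstr

open FirstOrder.Language FirstOrder.Language.Structure

/-! ### Measurability of the isomorphism class -/

section Measurability

lemma measurableSet_realize {α : Type*} {n : ℕ} (ψ : Language.graph.BoundedFormula α n) (v : α → ℕ)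
    (xs : Fin n → ℕ) :
    MeasurableSet {H : SimpleGraph ℕ | letI := H.structure; ψ.Realize v xs} := by
  induction ψ with
  | falsum => exact MeasurableSet.empty
  | equal t u =>
    obtain ⟨x, rfl⟩ := exists_var_eq t
    obtain ⟨y, rfl⟩ := exists_var_eq u
    exact MeasurableSet.const
      (Sum.elim v xs x = Sum.elim v xs y)
  | rel R ts =>
    obtain rfl := relations_eq_two R
    obtain ⟨x, hx⟩ := exists_var_eq (ts 0)
    obtain ⟨y, hy⟩ := exists_var_eq (ts 1)
    have h := SimpleGraph.measurable_iff_adj.1 (measurable_id (α := SimpleGraph ℕ))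
      (Sum.elim v xs x) (Sum.elim v xs y)
    convert measurableSet_setOfPred.2 h using 1
    ext H
    let _ := H.structure
    change RelMap R (fun i => (ts i).realize (Sum.elim v xs)) ↔ _
    rw [relMap_adj, hx, hy]
    rfl
  | imp ψ₁ ψ₂ ih₁ ih₂ => exact (ih₁ xs).imp (ih₂ xs)
  | all ψ ih =>
    simp only [BoundedFormula.realize_all, Set.ofPred_forall]
    exact MeasurableSet.iInter fun x => ih (Fin.snoc xs x)

lemma measurableSet_holds (φ : PithyMatrix) (a : Fin φ.1 → ℕ) (b : ℕ) :
    MeasurableSet {H : SimpleGraph ℕ | φ.Holds H a b} :=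
  measurableSet_realize φ.2 _ _

variable {V : Type*} {G : SimpleGraph V} [Nonempty V] [Countable V]

lemma IsPithyAxiomatization.measurableSet_isoClass {φ : ℕ → PithyMatrix}
    (hφ : IsPithyAxiomatization G φ) (hG : IsUltrahomogeneousGraph G) :
    MeasurableSet (isoClass G) := by
  have : isoClass G = ⋂ i, ⋂ a : Fin (φ i).1 → ℕ, ⋃ b, {H | (φ i).Holds H a b} := by
    ext H
    simp only [hφ.mem_isoClass_iff hG, Set.mem_iInter, Set.mem_iUnion, Set.mem_ofPred_eq]
  rw [this]
  exact MeasurableSet.iInter fun i => MeasurableSet.iInter fun a => MeasurableSet.iUnion fun b =>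
    measurableSet_holds _ _ _

end Measurability

/-! ### The tower of a run and witnesses in the limit graph -/

namespace Run

variable {V : Type*} {G : SimpleGraph V} {φ : ℕ → PithyMatrix} (R : Run G φ)

/-- The map that sends each vertex of stage `n + 1` to the vertex of stage `n` that it is an
offshoot of, and each new witness to itself. -/
def parentMap (n : ℕ) : V → V := (R.exists_parent n).choose

/-- The parent in stage `n`, if there is one, of a vertex of stage `n + 1`. -/
def parent (n : ℕ) (x : R.verts (n + 1)) : Option (R.verts n) :=
  open Classical in
  if h : R.parentMap n x ∈ R.verts n then some ⟨_, h⟩ else none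

lemma parent_eq_some_iff {n : ℕ} {x : R.verts (n + 1)} {w : R.verts n} :
    R.parent n x = some w ↔ R.parentMap n x = w := by
  rw [parent]
  split_ifs with h
  · rw [Option.some_inj, Subtype.ext_iff]
  · refine iff_of_false (by simp) fun h' => h ?_
    rw [h']
    exact w.2

lemma parentMap_eq_self {n : ℕ} {x : V} (hx : x ∈ R.slice (n + 1) (n + 1)) :
    x ∈ R.verts (n + 1) ∧ R.parentMap n x = x := by
  obtain ⟨h₁, h₂⟩ := (R.exists_parent n).choose_spec.2.2.2 x hx
  exact ⟨h₁, (h₂ x h₁).2 rfl⟩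

lemma parent_eq_none_iff {n : ℕ} {x : R.verts (n + 1)} :
    R.parent n x = none ↔ (x : V) ∈ R.slice (n + 1) (n + 1) := by
  have hp := (R.exists_parent n).choose_spec
  rw [parent]
  split_ifs with h
  · refine iff_of_false (by simp) fun h' => notMem_slice_of_mem_stage h' ?_
    rw [← (R.parentMap_eq_self h').2]
    exact h
  · refine iff_of_true rfl ?_
    have h' := (hp.1 x x.2).resolve_left h
    rwa [((hp.2.2.2 _ h').2 x x.2).1 rfl]

lemma isTower : IsTower (W := fun n => R.verts n) R.parent
    fun n => (R.slice (n + 1) (n + 1)).card where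
  pos n := (R.isNewSlice n).nonempty.card_pos
  card_none n := by
    simp only [R.parent_eq_none_iff]
    rw [Nat.card_congr (Equiv.subtypeSubtypeEquivSubtype fun h => (R.parentMap_eq_self h).1)]
    simp
  card_some n w := by
    simp only [R.parent_eq_some_iff]
    rw [← (R.exists_parent n).choose_spec.2.2.1 w w.2, ← Nat.card_coe_set_eq]
    exact Nat.card_congr (Equiv.subtypeSubtypeEquivSubtypeInter
      (fun x => x ∈ R.verts (n + 1)) fun x => R.parentMap n x = w)

lemma isTransversal : IsTransversal (W := fun n => R.verts n) R.graph R.parent := by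
  intro n x y w v hx hy hwv
  rw [R.parent_eq_some_iff] at hx hy
  have := (R.exists_parent n).choose_spec.2.1 x x.2 y y.2 (by
    change R.parentMap n x ≠ R.parentMap n y
    rw [hx, hy]
    exact fun h => hwv (Subtype.ext h))
  change G.Adj x y ↔ G.Adj w v
  rw [this, ← hx, ← hy]
  rfl

/-- The trace `p` of `a` in stage `n` has the pattern of `a`. If no entry of `p` is a witness, the
slice added next contains a witness `d p`, and a chain `k` that sits on it at time `n + 1` and never
jumps later is a witness for `a`. Such a chain is available since `n + 1 ≥ 2`. -/
lemma exists_holds_limitGraph (hφ : IsPithyAxiomatization G φ) {Y : ℕ → ∀ n, R.verts n}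
    (hY : IsGenericFamily R.parent Y) {n : ℕ} (hn : 1 ≤ n) (a : Fin (φ (n + 1)).1 → ℕ)
    (h₁ : ∀ i, StableFrom R.parent (Y (a i)) n)
    (h₂ : ∀ i j, a i ≠ a j → Y (a i) n ≠ Y (a j) n) :
    ∃ b, (φ (n + 1)).Holds (limitGraph R.graph Y) a b := by
  set H := limitGraph R.graph Y with hH
  let p : Fin (φ (n + 1)).1 → V := fun i => Y (a i) n
  have hp : SamePattern H.Adj G.Adj a p :=
    (samePattern_limitGraph R.isTransversal h₁ h₂).trans
      fun i j => ⟨Subtype.ext_iff, Iff.rfl⟩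
  by_cases hex : ∃ i, (φ (n + 1)).Holds G p (p i)
  · obtain ⟨i, hi⟩ := hex
    refine ⟨a i, (holds_iff_of_samePattern (hφ.isQF _) ?_).1 hi⟩
    have := (hp.comp (Fin.snoc id i : Fin ((φ (n + 1)).1 + 1) → _)).symm
    rwa [Fin.comp_snoc, Fin.comp_snoc] at this
  · have hneeds : p ∈ needsWitness G (φ (n + 1)) (R.stage n n) := ⟨fun i => (Y (a i) n).2, hex⟩
    rcases R.isNewSlice n with ⟨-, d, -, hd, hB⟩ | ⟨h0, -⟩
    · have hdB : d p ∈ R.slice (n + 1) (n + 1) := by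
        rw [← Finset.mem_coe, hB]
        exact ⟨p, hneeds, rfl⟩
      obtain ⟨hdn, hdp⟩ := hd p hneeds
      obtain ⟨hdm, hdpar⟩ := R.parentMap_eq_self hdB
      obtain ⟨k, hk, hks⟩ := hY.exists_eq (n + 1) (by omega) ⟨d p, hdm⟩
      refine ⟨k, (holds_iff_of_samePattern (hφ.isQF _) ?_).1 hdp⟩
      let a' : Fin ((φ (n + 1)).1 + 1) → ℕ := Fin.snoc a k
      -- The chains `a` have not jumped, so their parents are the entries of `p`; the new witness is
      -- its own parent. Adjacencies at time `n + 1` are thus those of `(p, d p)`.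
      have hval : ∀ i, R.parentMap n (Y (a' i) (n + 1)) =
          (Fin.snoc p (d p) : Fin ((φ (n + 1)).1 + 1) → V) i := by
        intro i
        refine Fin.lastCases ?_ (fun i => ?_) i
        · simp only [a', Fin.snoc_last, hk, hdpar]
        · simp only [a', Fin.snoc_castSucc]
          exact R.parent_eq_some_iff.1 (h₁ i n le_rfl)
      have hinj : ∀ i j, a' i ≠ a' j →
          R.parentMap n (Y (a' i) (n + 1)) ≠ R.parentMap n (Y (a' j) (n + 1)) := by
        intro i j
        rw [hval, hval]
        refine Fin.lastCases ?_ (fun i => ?_) i <;> refine Fin.lastCases ?_ (fun j => ?_) j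
        · intro h
          exact absurd rfl h
        · intro _ h
          simp only [Fin.snoc_last, Fin.snoc_castSucc] at h
          exact hdn (h ▸ (Y (a j) n).2)
        · intro _ h
          simp only [Fin.snoc_last, Fin.snoc_castSucc] at h
          exact hdn (h ▸ (Y (a i) n).2)
        · simp only [a', Fin.snoc_castSucc]
          exact fun h h' => h₂ i j h (Subtype.ext h')
      have hstable : ∀ i, StableFrom R.parent (Y (a' i)) (n + 1) := fun i => by
        refine Fin.lastCases ?_ (fun i => ?_) i
        · simpa only [a', Fin.snoc_last] using hks
        · simpa only [a', Fin.snoc_castSucc] using (h₁ i).mono (Nat.le_succ n)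
      have hpat := samePattern_limitGraph R.isTransversal hstable
        fun i j h h' => hinj i j h (by rw [h'])
      refine SamePattern.symm fun i j => ?_
      rw [← hval, ← hval]
      by_cases hij : a' i = a' j
      · change (a' i = a' j ↔ _) ∧ (H.Adj (a' i) (a' j) ↔ _)
        simp [hij]
      · refine ⟨iff_of_false hij (hinj i j hij), (hpat i j).2.trans ?_⟩
        exact (R.exists_parent n).choose_spec.2.1 _ (Y (a' i) (n + 1)).2 _ (Y (a' j) (n + 1)).2
          (hinj i j hij)
    · rw [h0] at hneeds
      exact hneeds.elim

lemma limitGraph_mem_isoClass [Nonempty V] [Countable V] (hG : IsUltrahomogeneousGraph G)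
    (hφ : IsPithyAxiomatization G φ) {Y : ℕ → ∀ n, R.verts n} (hY : IsGenericFamily R.parent Y) :
    limitGraph R.graph Y ∈ isoClass G := by
  rw [hφ.mem_isoClass_iff hG]
  intro i a
  obtain ⟨N, hN⟩ := eventually_atTop.1 (hY.eventually a)
  -- The bound `N + 1` ensures that the stage `n = j - 1` is past `N` and at least `1`.
  obtain ⟨j, hj, hjN⟩ := (hφ.infinitely_often i).exists_gt (N + 1)
  obtain ⟨n, rfl⟩ : ∃ n, j = n + 1 := ⟨j - 1, by omega⟩
  -- The type of `a` depends on the formula, so the formula is generalized before it is replaced by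
  -- `φ (n + 1)`.
  have key : ∀ ψ, φ (n + 1) = ψ → ∀ a : Fin ψ.1 → ℕ,
      ((∀ i, StableFrom R.parent (Y (a i)) n) ∧ ∀ i j, a i ≠ a j → Y (a i) n ≠ Y (a j) n) →
      ∃ b, ψ.Holds (limitGraph R.graph Y) a b := by
    rintro _ rfl a ⟨h₁, h₂⟩
    exact R.exists_holds_limitGraph hφ hY (by omega) a h₁ h₂
  exact key _ hj a (hN n (by omega))

end Run

end ToyConstr

end

theorem mainTheorem8 {V : Type*} [Countable V] [Infinite V] (G : SimpleGraph V)
    (hG : ToyConstr.IsUltrahomogeneousGraph G) (hdcl : ToyConstr.HasTrivialDclGraph G) :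
    (∃ φ : ℕ → ToyConstr.PithyMatrix, ToyConstr.IsPithyAxiomatization G φ) ∧
    ∀ φ : ℕ → ToyConstr.PithyMatrix, ToyConstr.IsPithyAxiomatization G φ →
      (∀ X₀ : Finset V, X₀.Nonempty → ∃ R : ToyConstr.Run G φ, R.stage 0 0 = X₀) ∧
      ∀ R : ToyConstr.Run G φ, ∃ μ : ProbabilityMeasure (SimpleGraph ℕ),
        Tendsto (fun n => ToyConstr.sampledGraph (R.graph n)) atTop (𝓝 μ) ∧
        ToyConstr.IsSymInvariant (μ : Measure (SimpleGraph ℕ)) ∧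
        ToyConstr.IsConcentratedOn (μ : Measure (SimpleGraph ℕ)) (ToyConstr.isoClass G) := by
  refine ⟨ToyConstr.exists_isPithyAxiomatization hG, fun φ hφ =>
    ⟨fun X₀ hX₀ => ToyConstr.exists_run hdcl hφ hX₀, fun R => ?_⟩⟩
  obtain ⟨μ, h₁, h₂, h₃⟩ := R.isTower.exists_limit R.isTransversal
  have hm := hφ.measurableSet_isoClass hG
  exact ⟨μ, h₁, h₂, hm, h₃ _ hm fun Y hY => R.limitGraph_mem_isoClass hG hφ hY⟩
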